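/- A shift space is a closed, shift-invariant subset $X$ of $\mathcal A^{\mathbb Z}$ for a finite alphabet $\mathcal A$ (discrete topology on $\mathcal A$, product topology on $\mathcal A^{\mathbb Z}$), with shift map $\sigma(x)_i = x_{i+1}$. It is of finite type if, for some $k \ge 0$, there is a set $\mathcal F$ of words of length $k+1$ over $\mathcal A$ such that $X$ consists of all sequences in $\mathcal A^{\mathbb Z}$ containing no word of $\mathcal F$. The entropy of $X$ is $h(X) = \lim_{n\to\infty} \frac1n \log |\mathcal B_n(X)|$, where $\mathcal B_n(X)$ is the set of words of length $n$ appearing in points of $X$ (with the convention $h(\emptyset)=0$). A factor code is a continuous surjective map between shift spaces that commutes with $\sigma$. Theorem. Let $\phi : X \to Y$ be a factor code between shift spaces, with $X$ of finite type, and let $$\mathcal S_0(\phi) = \{\, h(\phi_1(X)) : \phi = \phi_2 \circ \phi_1 \text{ with } \phi_1, \phi_2 \text{ factor codes and } \phi_1(X) \text{ a shift space of finite type} \,\}.$$ Then $\mathcal S_0(\phi)$ is dense in $[h(Y), h(X)]$; that is, $\mathcal S_0(\phi) \subseteq [h(Y),h(X)]$ and every point of $[h(Y),h(X)]$ is a limit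 of points of $\mathcal S_0(\phi)$. -/

import Mathlib

open Filter Topology SymbolicDynamics.FullShift

noncomputable section

namespace ShiftSpace

/-- The word `w = w₀ w₁ ⋯ wₙ₋₁` occurs in the bi-infinite sequence `x` at position `i`. -/
def OccursAt {A : Type*} {n : ℕ} (w : Fin n → A) (x : ℤ → A) (i : ℤ) : Prop :=
  ∀ j : Fin n, x (i + (j : ℤ)) = w j

/-- `words X n` is the set `𝓑ₙ(X)` of all words of length `n` appearing in points of `X`. -/
def words {A : Type*} [TopologicalSpace A] (X : Subshift A ℤ) (n : ℕ) : Set (Fin n → A) :=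
  {w | ∃ x ∈ X.carrier, ∃ i : ℤ, OccursAt w x i}

/-- The entropy `h(X) = lim (1/n) log |𝓑ₙ(X)|` (natural logarithm) of a shift space. For a finite
alphabet the limit exists, see `tendsto_entropy`. -/
def entropy {A : Type*} [TopologicalSpace A] (X : Subshift A ℤ) : ℝ :=
  limUnder atTop fun n : ℕ => (1 / (n : ℝ)) * Real.log ((words X n).ncard : ℝ)

/-- A shift space is of finite type if, for some `k ≥ 0`, it is the set of all sequences that
contain no word of some set `F` of words of length `k + 1`. -/
def IsFiniteType {A : Type*} [TopologicalSpace A] (X : Subshift A ℤ) : Prop :=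
  ∃ (k : ℕ) (F : Set (Fin (k + 1) → A)),
    X.carrier = {x | ∀ w ∈ F, ∀ i : ℤ, ¬ OccursAt w x i}

/-- The shift map `σ` on a shift space. -/
def sigma {A : Type*} [TopologicalSpace A] (X : Subshift A ℤ) (x : X.carrier) : X.carrier :=
  ⟨shift 1 x.1, X.mapsTo 1 x.2⟩

/-- A code is a continuous map between shift spaces that commutes with the shift maps. -/
structure IsCode {A B : Type*} [TopologicalSpace A] [TopologicalSpace B]
    {X : Subshift A ℤ} {Y : Subshift B ℤ} (φ : X.carrier → Y.carrier) : Prop where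
  continuous : Continuous φ
  map_sigma : ∀ x, φ (sigma X x) = sigma Y (φ x)

/-- A factor code is a surjective code. -/
structure IsFactorCode {A B : Type*} [TopologicalSpace A] [TopologicalSpace B]
    {X : Subshift A ℤ} {Y : Subshift B ℤ} (φ : X.carrier → Y.carrier) : Prop
    extends IsCode φ where
  surjective : Function.Surjective φ

/-- The set `𝒮₀(φ)` of all entropies `h(φ₁(X))` over the decompositions `φ = φ₂ ∘ φ₁` into factor
codes through a shift space `Z = φ₁(X)` of finite type (over an arbitrary finite alphabet `C`). -/
def finiteTypeEntropies {A B : Type*} [TopologicalSpace A] [TopologicalSpace B]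
    {X : Subshift A ℤ} {Y : Subshift B ℤ} (φ : X.carrier → Y.carrier) : Set ℝ :=
  {h | ∃ (C : Type) (_ : Finite C) (_ : TopologicalSpace C) (_ : DiscreteTopology C)
      (Z : Subshift C ℤ) (φ₁ : X.carrier → Z.carrier) (φ₂ : Z.carrier → Y.carrier),
      IsFactorCode φ₁ ∧ IsFactorCode φ₂ ∧ φ = φ₂ ∘ φ₁ ∧ IsFiniteType Z ∧ h = entropy Z}

/-- The number of words is submultiplicative. -/
theorem ncard_words_add_le {A : Type*} [TopologicalSpace A] [Finite A] (X : Subshift A ℤ)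
    (m n : ℕ) : (words X (m + n)).ncard ≤ (words X m).ncard * (words X n).ncard := by
  rw [← Set.ncard_prod]
  refine Set.ncard_le_ncard_of_injOn
    (fun w => (fun j => w (Fin.castAdd n j), fun j => w (Fin.natAdd m j))) ?_ ?_ (Set.toFinite _)
  · rintro w ⟨x, hx, i, hw⟩
    refine ⟨⟨x, hx, i, fun j => hw (Fin.castAdd n j)⟩, ⟨x, hx, i + m, fun j => ?_⟩⟩
    have := hw (Fin.natAdd m j)
    simpa [add_assoc] using this
  · intro v _ w _ hvw
    simp only [Prod.mk.injEq] at hvw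
    funext j
    induction j using Fin.addCases with
    | left j => exact congrFun hvw.1 j
    | right j => exact congrFun hvw.2 j

/-- The limit defining the entropy exists. -/
theorem tendsto_entropy {A : Type*} [TopologicalSpace A] [Finite A] (X : Subshift A ℤ) :
    Tendsto (fun n : ℕ => (1 / (n : ℝ)) * Real.log ((words X n).ncard : ℝ)) atTop
      (𝓝 (entropy X)) := by
  have hsub : Subadditive fun n : ℕ => Real.log ((words X n).ncard : ℝ) := by
    intro m n
    rcases Nat.eq_zero_or_pos (words X (m + n)).ncard with h0 | hpos
    · simp only [h0, Nat.cast_zero, Real.log_zero]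
      exact add_nonneg (Real.log_natCast_nonneg _) (Real.log_natCast_nonneg _)
    · have hle := ncard_words_add_le X m n
      have hm : (words X m).ncard ≠ 0 := fun h => by simp [h] at hle; omega
      have hn : (words X n).ncard ≠ 0 := fun h => by simp [h] at hle; omega
      rw [← Real.log_mul (by exact_mod_cast hm) (by exact_mod_cast hn)]
      exact Real.log_le_log (by exact_mod_cast hpos) (by exact_mod_cast hle)
  have hbdd : BddBelow (Set.range fun n : ℕ => Real.log ((words X n).ncard : ℝ) / n) := by
    refine ⟨0, ?_⟩
    rintro _ ⟨n, rfl⟩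
    exact div_nonneg (Real.log_natCast_nonneg _) n.cast_nonneg
  have h := hsub.tendsto_lim hbdd
  refine tendsto_nhds_limUnder ⟨hsub.lim, ?_⟩
  simpa only [one_div_mul_eq_div] using h

end ShiftSpace

end

/-! A code is a sliding block code, so a local map `f` on `X` from which `φ` can be read letter by
letter gives an intermediate shift space `f(X)`. It suffices to find such `f` with entropies
`ε`-dense between `h(Y)` and `h(X)`, and then to refine each to a map with image of finite type at a
small cost in entropy.

Density: add to `φ` the occurrences of the words of length `k`, one word after another, until the
point is known. In a window of length `k`, the occurrences of one such word are determined by the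
first and the last, so each addition costs at most `log (k² + 1) / k`
(`entropy_le_of_determines_occursAt`).

Finite type: long blocks of a point of `X` serve as states at which points can be exchanged. Markers
depending only on the labels `f x` lie at least `N` apart, and far from them the labels have a
period below `N` (`exists_marker`). `reveal` adds the state at a marker and, far from markers, the
set of states leading to the present one in time `P`. For a suitable common multiple `P` of the
periods, reachability in time `P` over a periodic stretch is transitive. Predecessor sets along a
point then increase and stabilise, and two points with the same revealed data are joined by a path
with the same data (`exists_marker_glue`). Gluing across bounded windows makes the image of finite
type. The cost is one state per `N` positions and, for each state, one entry time per `P` positions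
(`entropy_le_of_reveal`). -/

open Filter Topology SymbolicDynamics.FullShift

noncomputable section

namespace ShiftSpace

/-! ### Local maps and their images -/

/-- Every power of the shift map, acting on the points of a shift space. -/
def shiftBy {A : Type*} [TopologicalSpace A] (X : Subshift A ℤ) (k : ℤ) (x : X.carrier) :
    X.carrier :=
  ⟨shift k x.1, X.mapsTo k x.2⟩

@[simp] theorem shiftBy_apply {A : Type*} [TopologicalSpace A] (X : Subshift A ℤ) (k : ℤ)
    (x : X.carrier) (i : ℤ) : (shiftBy X k x).1 i = x.1 (k + i) := rfl

/-- A map from a shift space to sequences that is equivariant and given by a finite window. -/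
structure IsLocal {A C : Type*} [TopologicalSpace A] {X : Subshift A ℤ}
    (f : X.carrier → ℤ → C) : Prop where
  map_shift : ∀ (k : ℤ) (x : X.carrier) (i : ℤ), f (shiftBy X k x) i = f x (k + i)
  window : ∃ m : ℕ, ∀ (x x' : X.carrier) (i : ℤ),
    (∀ j : ℤ, i - m ≤ j → j ≤ i + m → x.1 j = x'.1 j) → f x i = f x' i

theorem isOpen_agree {A : Type*} [TopologicalSpace A] [DiscreteTopology A] {X : Subshift A ℤ}
    (x : X.carrier) (a b : ℤ) :
    IsOpen {x' : X.carrier | ∀ j : ℤ, a ≤ j → j ≤ b → x.1 j = x'.1 j} := by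
  have h : {x' : X.carrier | ∀ j : ℤ, a ≤ j → j ≤ b → x.1 j = x'.1 j} =
      ⋂ j ∈ Finset.Icc a b, {x' : X.carrier | x'.1 j = x.1 j} := by
    ext x'
    simp only [Set.mem_ofPred_eq, Set.mem_iInter, Finset.mem_Icc, and_imp]
    exact ⟨fun h j h1 h2 => (h j h1 h2).symm, fun h j h1 h2 => (h j h1 h2).symm⟩
  rw [h]
  refine isOpen_biInter_finset fun j _ => ?_
  have hc : Continuous fun x' : X.carrier => x'.1 j :=
    (continuous_apply j).comp continuous_subtype_val
  exact (isOpen_discrete {x.1 j}).preimage hc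

theorem IsLocal.continuous {A C : Type*} [TopologicalSpace A] [DiscreteTopology A]
    [TopologicalSpace C] {X : Subshift A ℤ} {f : X.carrier → ℤ → C} (hf : IsLocal f) :
    Continuous f := by
  obtain ⟨m, hm⟩ := hf.window
  refine continuous_pi fun i => IsLocallyConstant.continuous ?_
  rw [IsLocallyConstant.iff_exists_open]
  exact fun x => ⟨_, isOpen_agree x (i - m) (i + m), fun j _ _ => rfl,
    fun x' h => (hm x x' i h).symm⟩

theorem compactSpace_carrier {A : Type*} [TopologicalSpace A] [Finite A] (X : Subshift A ℤ) :
    CompactSpace X.carrier :=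
  isCompact_iff_compactSpace.mp X.isClosed.isCompact

/-- The image of a local map is a shift space. -/
def rangeShift {A C : Type*} [TopologicalSpace A] [DiscreteTopology A] [Finite A]
    [TopologicalSpace C] [T2Space C] {X : Subshift A ℤ} (f : X.carrier → ℤ → C)
    (hf : IsLocal f) : Subshift C ℤ where
  carrier := Set.range f
  isClosed := by
    have := compactSpace_carrier X
    exact (isCompact_range hf.continuous).isClosed
  mapsTo := by
    rintro k _ ⟨x, rfl⟩
    exact ⟨shiftBy X k x, funext fun i => hf.map_shift k x i⟩

theorem isLocal_val {A : Type*} [TopologicalSpace A] (X : Subshift A ℤ) :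
    IsLocal (fun x : X.carrier => x.1) :=
  ⟨fun _ _ _ => rfl, 0, fun x x' i h => h i (by simp) (by simp)⟩

theorem IsCode.map_shiftBy {A B : Type*} [TopologicalSpace A] [TopologicalSpace B]
    {X : Subshift A ℤ} {Y : Subshift B ℤ} {φ : X.carrier → Y.carrier} (hφ : IsCode φ)
    (k : ℤ) (x : X.carrier) (i : ℤ) : (φ (shiftBy X k x)).1 i = (φ x).1 (k + i) := by
  have one : ∀ (x : X.carrier) (i : ℤ), (φ (shiftBy X 1 x)).1 i = (φ x).1 (1 + i) := fun x i =>
    congrFun (congrArg Subtype.val (hφ.map_sigma x)) i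
  have add : ∀ (a b : ℤ) (x : X.carrier), shiftBy X a (shiftBy X b x) = shiftBy X (a + b) x := by
    intro a b x
    ext i
    exact congrArg x.1 (show b + (a + i) = a + b + i by ring)
  induction k using Int.induction_on generalizing x i with
  | zero =>
    have : shiftBy X 0 x = x := by ext i; simp
    rw [this, zero_add]
  | succ k ih =>
    rw [add_comm, ← add, one, ih]
    exact congrArg (φ x).1 (show (k : ℤ) + (1 + i) = 1 + k + i by ring)
  | pred k ih =>
    have h := one (shiftBy X (-k - 1) x) (i - 1)
    rw [add, show (1 : ℤ) + (-k - 1) = -k by ring, ih, show 1 + (i - 1) = i by ring] at h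
    rw [← h]
    exact congrArg (φ x).1 (show -(k : ℤ) + (i - 1) = -k - 1 + i by ring)

/-- Curtis–Hedlund–Lyndon: the sets `U m` of points whose coordinates in `[-m, m]` determine
coordinate `0` of the image are open, increasing and cover `X`, so compactness gives one window. -/
theorem IsCode.isLocal {A B : Type*} [TopologicalSpace A] [DiscreteTopology A] [Finite A]
    [TopologicalSpace B] [DiscreteTopology B]
    {X : Subshift A ℤ} {Y : Subshift B ℤ} {φ : X.carrier → Y.carrier} (hφ : IsCode φ) :
    IsLocal (fun x => (φ x).1) := by
  refine ⟨hφ.map_shiftBy, ?_⟩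
  have := compactSpace_carrier X
  let g : X.carrier → B := fun x => (φ x).1 0
  have hg : Continuous g := (continuous_apply 0).comp (continuous_subtype_val.comp hφ.continuous)
  let U : ℕ → Set X.carrier := fun m =>
    {x | ∀ x' : X.carrier, (∀ j : ℤ, -m ≤ j → j ≤ m → x.1 j = x'.1 j) → g x = g x'}
  have hmono : ∀ m n, m ≤ n → U m ⊆ U n := fun m n hmn x hx x' h =>
    hx x' fun j h1 h2 => h j (by omega) (by omega)
  have hopen : ∀ m, IsOpen (U m) := by
    intro m
    rw [isOpen_iff_forall_mem_open]
    refine fun x hx => ⟨_, ?_, isOpen_agree x (-m) m, fun j _ _ => rfl⟩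
    intro x' hx' x'' hx''
    rw [← hx x' hx']
    exact hx x'' fun j h1 h2 => (hx' j h1 h2).trans (hx'' j h1 h2)
  have hcover : Set.univ ⊆ ⋃ m, U m := by
    intro x _
    obtain ⟨V, hV, hVg⟩ := isOpen_induced_iff.mp ((isOpen_discrete {g x}).preimage hg)
    have hxV : x.1 ∈ V := by
      have : x ∈ Subtype.val ⁻¹' V := by rw [hVg]; rfl
      exact this
    obtain ⟨I, u, hu, hI⟩ := isOpen_pi_iff.mp hV x.1 hxV
    refine Set.mem_iUnion.mpr ⟨I.sup Int.natAbs, fun x' hx' => ?_⟩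
    have : x' ∈ Subtype.val ⁻¹' V := by
      refine hI fun j hj => ?_
      have hle : j.natAbs ≤ I.sup Int.natAbs := Finset.le_sup (f := Int.natAbs) hj
      rw [← hx' j (by omega) (by omega)]
      exact (hu j hj).2
    rw [hVg] at this
    exact (Set.mem_singleton_iff.mp this).symm
  obtain ⟨m, hm⟩ := isCompact_univ.elim_directed_cover U hopen hcover
    (directed_of_isDirected_le hmono)
  refine ⟨m, fun x x' i h => ?_⟩
  have h0 := hm (Set.mem_univ (shiftBy X i x)) (shiftBy X i x') fun j h1 h2 => by
    simpa using h (i + j) (by omega) (by omega)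
  simpa [g, hφ.map_shiftBy] using h0

/-! ### Entropy comparison by counting words -/

theorem words_eq_range {A C : Type*} [TopologicalSpace A] [TopologicalSpace C]
    {X : Subshift A ℤ} {Z : Subshift C ℤ} {f : X.carrier → ℤ → C} (hf : IsLocal f)
    (hZ : Z.carrier = Set.range f) (n : ℕ) (a : ℤ) :
    words Z n = Set.range fun (x : X.carrier) (j : Fin n) => f x (a + j) := by
  ext w
  constructor
  · rintro ⟨z, hz, i, hw⟩
    rw [hZ] at hz
    obtain ⟨x, rfl⟩ := hz
    refine ⟨shiftBy X (i - a) x, funext fun j => ?_⟩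
    rw [← hw j]
    simp only [hf.map_shift]
    congr 1
    ring
  · rintro ⟨x, rfl⟩
    exact ⟨f x, hZ ▸ ⟨x, rfl⟩, a, fun j => rfl⟩

theorem ncard_range_le_of_determines {X S T D : Type*} [Finite T] [Finite D] (f : X → S)
    (g : X → T) (d : X → D) (h : ∀ x x', g x = g x' → d x = d x' → f x = f x') :
    (Set.range f).ncard ≤ (Set.range g).ncard * Nat.card D := by
  rcases isEmpty_or_nonempty X with hX | ⟨⟨x₀⟩⟩
  · rw [Set.range_eq_empty, Set.ncard_empty]
    exact Nat.zero_le _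
  classical
  let F : T × D → S := fun p => if hp : ∃ x, g x = p.1 ∧ d x = p.2 then f hp.choose else f x₀
  have hsub : Set.range f ⊆ F '' (Set.range g ×ˢ Set.univ) := by
    rintro _ ⟨x, rfl⟩
    refine ⟨(g x, d x), ⟨⟨x, rfl⟩, trivial⟩, ?_⟩
    have hp : ∃ x', g x' = (g x, d x).1 ∧ d x' = (g x, d x).2 := ⟨x, rfl, rfl⟩
    simp only [F, dif_pos hp]
    exact h _ _ hp.choose_spec.1 hp.choose_spec.2
  calc (Set.range f).ncard ≤ (F '' (Set.range g ×ˢ Set.univ)).ncard :=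
        Set.ncard_le_ncard hsub (Set.toFinite _)
    _ ≤ (Set.range g ×ˢ (Set.univ : Set D)).ncard := Set.ncard_image_le (Set.toFinite _)
    _ = _ := by rw [Set.ncard_prod, Set.ncard_univ]

/-- The `m` extra letters cost nothing since `(n + m) / n → 1`; of the error only its slope
survives. -/
theorem entropy_le_of_log_ncard_le {A B : Type*} [TopologicalSpace A] [Finite A]
    [TopologicalSpace B] [Finite B] (Z : Subshift A ℤ) (Y : Subshift B ℤ) (m : ℕ) (c d : ℝ)
    (h : ∀ n : ℕ, Real.log ((words Z n).ncard : ℝ) ≤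
      Real.log ((words Y (n + m)).ncard : ℝ) + c * n + d) :
    entropy Z ≤ entropy Y + c := by
  have hY := (tendsto_entropy Y).comp (tendsto_add_atTop_nat m)
  have hinv : Tendsto (fun n : ℕ => 1 / (n : ℝ)) atTop (𝓝 0) := tendsto_one_div_atTop_nhds_zero_nat
  have hlim : Tendsto (fun n : ℕ => (1 + (m : ℝ) * (1 / (n : ℝ))) *
      ((1 / ((n + m : ℕ) : ℝ)) * Real.log ((words Y (n + m)).ncard : ℝ)) + c + d * (1 / (n : ℝ)))
      atTop (𝓝 ((1 + (m : ℝ) * 0) * entropy Y + c + d * 0)) :=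
    (((tendsto_const_nhds.add (hinv.const_mul _)).mul hY).add_const c).add (hinv.const_mul _)
  rw [mul_zero, mul_zero, add_zero, add_zero, one_mul] at hlim
  refine le_of_tendsto_of_tendsto (tendsto_entropy Z) hlim ?_
  filter_upwards [eventually_gt_atTop 0] with n hn
  have hn' : (0 : ℝ) < n := by exact_mod_cast hn
  have hnm : (0 : ℝ) < (n : ℝ) + m := by positivity
  calc 1 / (n : ℝ) * Real.log ((words Z n).ncard : ℝ)
      ≤ 1 / (n : ℝ) * (Real.log ((words Y (n + m)).ncard : ℝ) + c * n + d) :=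
        mul_le_mul_of_nonneg_left (h n) (by positivity)
    _ = _ := by
        push_cast
        field_simp

/-- If the coordinates of `f x` in `[0, n)` are determined by those of `g x` in `[-m, n + m)`
together with a datum from a set of at most `exp (c n + d)` elements, then the entropy of the image
of `f` exceeds that of `g` by at most `c`. -/
theorem entropy_le_of_determines {A C D : Type*} [TopologicalSpace A]
    [TopologicalSpace C] [Finite C] [TopologicalSpace D] [Finite D] {X : Subshift A ℤ}
    {Z : Subshift C ℤ} {Y : Subshift D ℤ} {f : X.carrier → ℤ → C} {g : X.carrier → ℤ → D}
    (hf : IsLocal f) (hg : IsLocal g) (hZ : Z.carrier = Set.range f) (hY : Y.carrier = Set.range g)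
    (m : ℕ) (c d : ℝ)
    (h : ∀ n : ℕ, ∃ (T : Type) (_ : Finite T) (δ : X.carrier → T),
      (∀ x x' : X.carrier, (∀ i : ℤ, -m ≤ i → i < n + m → g x i = g x' i) → δ x = δ x' →
        ∀ i : ℤ, 0 ≤ i → i < n → f x i = f x' i) ∧ Real.log (Nat.card T : ℝ) ≤ c * n + d) :
    entropy Z ≤ entropy Y + c := by
  refine entropy_le_of_log_ncard_le Z Y (2 * m) c d fun n => ?_
  obtain ⟨T, _, δ, hδ, hT⟩ := h n
  rw [words_eq_range hf hZ n 0, words_eq_range hg hY (n + 2 * m) (-m)]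
  have hle := ncard_range_le_of_determines (fun (x : X.carrier) (j : Fin n) => f x (0 + j))
    (fun (x : X.carrier) (j : Fin (n + 2 * m)) => g x (-m + j)) δ (by
      intro x x' hg' hd
      funext j
      refine hδ x x' (fun i h1 h2 => ?_) hd _ (by omega) (by omega)
      have := congrFun hg' ⟨(i + m).toNat, by omega⟩
      simpa [Int.toNat_of_nonneg (show 0 ≤ i + m by omega)] using this)
  set a := (Set.range fun (x : X.carrier) (j : Fin n) => f x (0 + j)).ncard
  set b := (Set.range fun (x : X.carrier) (j : Fin (n + 2 * m)) => g x (-m + j)).ncard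
  -- For empty `X` both counts vanish, and the bound holds because `Real.log 0 = 0`.
  rcases isEmpty_or_nonempty X.carrier with hX | ⟨⟨x₀⟩⟩
  · have ha : a = 0 := by simp only [a, Set.range_eq_empty, Set.ncard_empty]
    have hb : b = 0 := by simp only [b, Set.range_eq_empty, Set.ncard_empty]
    rw [ha, hb]
    simp only [Nat.cast_zero, Real.log_zero, zero_add]
    exact (Real.log_natCast_nonneg _).trans hT
  · have ha : 0 < a := (Set.ncard_pos (Set.toFinite _)).mpr ⟨_, ⟨x₀, rfl⟩⟩
    have hpos : 0 < b * Nat.card T := ha.trans_le hle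
    have hb : b ≠ 0 := fun h0 => by simp [h0] at hpos
    have hT0 : Nat.card T ≠ 0 := fun h0 => by simp [h0] at hpos
    calc Real.log (a : ℝ) ≤ Real.log ((b : ℝ) * Nat.card T) :=
          Real.log_le_log (by exact_mod_cast ha) (by exact_mod_cast hle)
      _ = Real.log b + Real.log (Nat.card T) :=
          Real.log_mul (by exact_mod_cast hb) (by exact_mod_cast hT0)
      _ ≤ _ := by linarith

theorem IsFactorCode.carrier_eq_range {A B : Type*} [TopologicalSpace A] [TopologicalSpace B]
    {X : Subshift A ℤ} {Y : Subshift B ℤ} {φ : X.carrier → Y.carrier} (hφ : IsFactorCode φ) :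
    Y.carrier = Set.range fun x => (φ x).1 := by
  ext y
  refine ⟨fun hy => ?_, ?_⟩
  · obtain ⟨x, hx⟩ := hφ.surjective ⟨y, hy⟩
    exact ⟨x, by simp [hx]⟩
  · rintro ⟨x, rfl⟩
    exact (φ x).2

/-- A factor does not have larger entropy. -/
theorem IsFactorCode.entropy_le {A B : Type*} [TopologicalSpace A] [DiscreteTopology A] [Finite A]
    [TopologicalSpace B] [DiscreteTopology B] [Finite B]
    {X : Subshift A ℤ} {Y : Subshift B ℤ} {φ : X.carrier → Y.carrier} (hφ : IsFactorCode φ) :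
    entropy Y ≤ entropy X := by
  have hloc := hφ.toIsCode.isLocal
  obtain ⟨m, hm⟩ := hloc.window
  have h := entropy_le_of_determines hloc (isLocal_val X) hφ.carrier_eq_range
    Subtype.range_val.symm m 0 0
    fun n => ⟨Unit, inferInstance, fun _ => (), fun x x' hxx _ i h1 h2 =>
      hm x x' i fun j h3 h4 => hxx j (by omega) (by omega), by simp⟩
  simpa using h

/-! ### A gluing criterion for finite type -/

/-- A shift space is of finite type if each long word all of whose subwords of length `W` are
allowed is itself allowed; it suffices to extend words by one letter at a time. -/
theorem isFiniteType_of_extend {C : Type*} [TopologicalSpace C] [DiscreteTopology C]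
    (Z : Subshift C ℤ) (W : ℕ) (hW : 0 < W)
    (h : ∀ (n : ℕ) (z : ℤ → C), W ≤ n →
      (∃ x ∈ Z.carrier, ∀ i : ℤ, 0 ≤ i → i < n → x i = z i) →
      (∃ x ∈ Z.carrier, ∀ i : ℤ, n + 1 - W ≤ i → i < n + 1 → x i = z i) →
      ∃ x ∈ Z.carrier, ∀ i : ℤ, 0 ≤ i → i < n + 1 → x i = z i) : IsFiniteType Z := by
  refine ⟨W - 1, (words Z (W - 1 + 1))ᶜ, Set.Subset.antisymm ?_ ?_⟩
  · intro x hx w hw i hi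
    exact hw ⟨x, hx, i, hi⟩
  · intro z hz
    have hsub : ∀ i : ℤ, ∃ x ∈ Z.carrier, ∀ j : ℤ, i ≤ j → j < i + W → x j = z j := by
      intro i
      have hw : (fun j : Fin (W - 1 + 1) => z (i + j)) ∈ words Z (W - 1 + 1) := by
        by_contra hn
        exact hz _ hn i fun j => rfl
      obtain ⟨x, hx, k, hk⟩ := hw
      refine ⟨shift (k - i) x, Z.mapsTo _ hx, fun j h1 h2 => ?_⟩
      have := hk ⟨(j - i).toNat, by omega⟩
      simp only [Int.toNat_of_nonneg (show 0 ≤ j - i by omega)] at this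
      rw [show z j = z (i + (j - i)) by congr 1; ring, ← this]
      change x (k - i + j) = _
      congr 1
      ring
    have hlong : ∀ (n : ℕ), W ≤ n → ∀ a : ℤ, ∃ x ∈ Z.carrier, ∀ j : ℤ, a ≤ j → j < a + n →
        x j = z j := by
      intro n hn
      induction n, hn using Nat.le_induction with
      | base => exact hsub
      | succ n hn ih =>
        intro a
        have tr : ∀ p q : ℤ, (∃ x ∈ Z.carrier, ∀ j : ℤ, a + p ≤ j → j < a + q → x j = z j) →
            ∃ x ∈ Z.carrier, ∀ i : ℤ, p ≤ i → i < q → x i = shift a z i := by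
          rintro p q ⟨x, hx, h⟩
          exact ⟨shift a x, Z.mapsTo a hx, fun i h1 h2 => h (a + i) (by omega) (by omega)⟩
        obtain ⟨x, hx, hxz⟩ := h n (shift a z) hn (tr 0 n (by simpa using ih a))
          (tr _ _ (by
            obtain ⟨x, hx, hxz⟩ := hsub (a + (n + 1 - W))
            exact ⟨x, hx, fun j h1 h2 => hxz j h1 (by omega)⟩))
        refine ⟨shift (-a) x, Z.mapsTo _ hx, fun j h1 h2 => ?_⟩
        have := hxz (-a + j) (by omega) (by push_cast at h2; omega)
        change x (-a + j) = _
        rw [this]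
        change z (a + (-a + j)) = _
        congr 1
        ring
    -- As `Z` is closed, matching `z` on every central window is enough.
    rw [← Z.isClosed.closure_eq, mem_closure_iff]
    intro V hV hzV
    obtain ⟨I, u, hu, hI⟩ := isOpen_pi_iff.mp hV z hzV
    set r := I.sup Int.natAbs
    obtain ⟨x, hx, hxz⟩ := hlong (W + 2 * r + 1) (by omega) (-r)
    refine ⟨x, hI fun j hj => ?_, hx⟩
    have hle : j.natAbs ≤ r := Finset.le_sup (f := Int.natAbs) hj
    rw [hxz j (by omega) (by push_cast; omega)]
    exact (hu j hj).2

/-! ### Interpolating entropy by revealing words -/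

theorem IsLocal.map {A C D : Type*} [TopologicalSpace A] {X : Subshift A ℤ}
    {f : X.carrier → ℤ → C} (hf : IsLocal f) (e : C → D) : IsLocal fun x i => e (f x i) := by
  obtain ⟨m, hm⟩ := hf.window
  exact ⟨fun k x i => congrArg e (hf.map_shift k x i), m, fun x x' i h =>
    congrArg e (hm x x' i h)⟩

theorem IsLocal.prodMk {A C D : Type*} [TopologicalSpace A] {X : Subshift A ℤ}
    {f : X.carrier → ℤ → C} {g : X.carrier → ℤ → D} (hf : IsLocal f) (hg : IsLocal g) :
    IsLocal fun x i => (f x i, g x i) := by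
  obtain ⟨m, hm⟩ := hf.window
  obtain ⟨n, hn⟩ := hg.window
  refine ⟨fun k x i => Prod.ext (hf.map_shift k x i) (hg.map_shift k x i), max m n,
    fun x x' i h => Prod.ext ?_ ?_⟩
  · exact hm x x' i fun j h1 h2 => h j (by push_cast; omega) (by push_cast; omega)
  · exact hn x x' i fun j h1 h2 => h j (by push_cast; omega) (by push_cast; omega)

/-- The word of length `n` seen from position `i + a`. -/
theorem isLocal_block {A : Type*} [TopologicalSpace A] (X : Subshift A ℤ) (n : ℕ) (a : ℤ) :
    IsLocal fun (x : X.carrier) (i : ℤ) (t : Fin n) => x.1 (i + a + t) := by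
  refine ⟨fun k x i => funext fun t => congrArg x.1 ?_, n + a.natAbs, fun x x' i h =>
    funext fun t => h _ ?_ ?_⟩
  · ring
  · rw [Nat.cast_add]; omega
  · rw [Nat.cast_add]; omega

/-- Two sequences that contain the word `w` at the same positions `f ≤ l`, where `l - f` is at most
the length of `w`, contain it at the same positions in between. -/
theorem OccursAt.transfer {A : Type*} {n : ℕ} {w : Fin n → A} {x x' : ℤ → A} {f j l : ℤ}
    (hfj : f ≤ j) (hjl : j ≤ l) (hfl : l ≤ f + n) (hf : OccursAt w x f) (hl : OccursAt w x l)
    (hf' : OccursAt w x' f) (hl' : OccursAt w x' l) (hj : OccursAt w x j) : OccursAt w x' j := by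
  intro t
  rw [← hj t]
  -- The copies of `w` at `f` and `l` cover `[f, l + n)`, hence the copy at `j`.
  by_cases ht : j + t < f + n
  · have h1 := hf ⟨(j + t - f).toNat, by omega⟩
    have h2 := hf' ⟨(j + t - f).toNat, by omega⟩
    simp only [Int.toNat_of_nonneg (show 0 ≤ j + t - f by omega), add_sub_cancel] at h1 h2
    rw [h1, h2]
  · have h1 := hl ⟨(j + t - l).toNat, by omega⟩
    have h2 := hl' ⟨(j + t - l).toNat, by omega⟩
    simp only [Int.toNat_of_nonneg (show 0 ≤ j + t - l by omega), add_sub_cancel] at h1 h2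
    rw [h1, h2]

theorem exists_first_last {k : ℕ} (p : Fin k → Prop) :
    ∃ d : Option (Fin k × Fin k), (d = none ∧ ∀ j, ¬ p j) ∨
      ∃ f l, d = some (f, l) ∧ p f ∧ p l ∧ ∀ j, p j → f ≤ j ∧ j ≤ l := by
  classical
  by_cases h : ∃ j, p j
  · obtain ⟨j₀, h₀⟩ := h
    have hne : (Finset.univ.filter p).Nonempty := ⟨j₀, by simpa using h₀⟩
    refine ⟨some (Finset.min' _ hne, Finset.max' _ hne), Or.inr ⟨_, _, rfl, ?_, ?_, ?_⟩⟩
    · simpa using Finset.min'_mem _ hne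
    · simpa using Finset.max'_mem _ hne
    · intro j hj
      have hj' : j ∈ Finset.univ.filter p := by simpa using hj
      exact ⟨Finset.min'_le _ _ hj', Finset.le_max' _ _ hj'⟩
  · exact ⟨none, Or.inl ⟨rfl, fun j hj => h ⟨j, hj⟩⟩⟩

theorem log_pow_div_add_one_le (b : ℝ) (hb : 1 ≤ b) (n k : ℕ) :
    Real.log (b ^ (n / k + 1)) ≤ Real.log b / k * n + Real.log b := by
  rw [Real.log_pow]
  push_cast
  have h : ((n / k : ℕ) : ℝ) ≤ (n : ℝ) / k := Nat.cast_div_le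
  calc (((n / k : ℕ) : ℝ) + 1) * Real.log b ≤ ((n : ℝ) / k + 1) * Real.log b :=
        mul_le_mul_of_nonneg_right (by linarith) (Real.log_nonneg hb)
    _ = _ := by ring

/-- Revealing the occurrences of one word of length `k` has a small entropy. -/
theorem entropy_le_of_determines_occursAt {A C D : Type*} [TopologicalSpace A]
    [TopologicalSpace C] [Finite C] [TopologicalSpace D] [Finite D] {X : Subshift A ℤ}
    {Z : Subshift C ℤ} {Y : Subshift D ℤ} {f : X.carrier → ℤ → C} {g : X.carrier → ℤ → D}
    (hf : IsLocal f) (hg : IsLocal g) (hZ : Z.carrier = Set.range f) (hY : Y.carrier = Set.range g)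
    {k : ℕ} (hk : 0 < k) (w : Fin k → A)
    (h : ∀ (x x' : X.carrier) (i : ℤ), g x i = g x' i →
      (OccursAt w x.1 i ↔ OccursAt w x'.1 i) → f x i = f x' i) :
    entropy Z ≤ entropy Y + Real.log ((k : ℝ) * k + 1) / k := by
  refine entropy_le_of_determines hf hg hZ hY 0 _ (Real.log ((k : ℝ) * k + 1)) fun n => ?_
  -- One datum per block of `k` positions: the first and last start of `w`, or none; `k² + 1`
  -- values.
  choose d hd using fun (x : X.carrier) (b : Fin (n / k + 1)) =>
    exists_first_last fun j : Fin k => OccursAt w x.1 ((b : ℕ) * k + j)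
  refine ⟨Fin (n / k + 1) → Option (Fin k × Fin k), inferInstance, d, ?_, ?_⟩
  · intro x x' hgx hdx i h1 h2
    obtain ⟨i, rfl⟩ := Int.eq_ofNat_of_zero_le h1
    refine h x x' i (hgx i (by omega) (by omega)) ?_
    have key : ∀ x x' : X.carrier, d x = d x' → OccursAt w x.1 i → OccursAt w x'.1 i := by
      intro x x' hdx ho
      have hb : i / k < n / k + 1 := Nat.lt_succ_of_le (Nat.div_le_div_right (by omega))
      have hi : (i : ℤ) = ((i / k : ℕ) : ℤ) * k + (i % k : ℕ) := by
        exact_mod_cast (Nat.div_add_mod' i k).symm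
      have hlt := Nat.mod_lt i hk
      rw [hi] at ho ⊢
      have e := congrFun hdx ⟨i / k, hb⟩
      rcases hd x ⟨i / k, hb⟩ with ⟨-, hn⟩ | ⟨f, l, hs, hf, hl, hfl⟩
      · exact absurd ho (hn ⟨i % k, hlt⟩)
      rcases hd x' ⟨i / k, hb⟩ with ⟨hs', -⟩ | ⟨f', l', hs', hf', hl', -⟩
      · rw [hs, hs'] at e
        cases e
      rw [hs, hs'] at e
      cases e
      obtain ⟨hfi, hil⟩ := hfl ⟨i % k, hlt⟩ ho
      rw [Fin.le_def] at hfi hil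
      simp only at hfi hil
      exact OccursAt.transfer (f := ((i / k : ℕ) : ℤ) * k + f) (l := ((i / k : ℕ) : ℤ) * k + l)
        (by omega) (by omega) (by omega) hf hl hf' hl' ho
    exact ⟨key x x' hdx, key x' x hdx.symm⟩
  · have hcard : (Nat.card (Fin (n / k + 1) → Option (Fin k × Fin k)) : ℝ) =
        ((k : ℝ) * k + 1) ^ (n / k + 1) := by simp
    rw [hcard]
    exact log_pow_div_add_one_le _ (by nlinarith [sq_nonneg (k : ℝ)]) n k

theorem tendsto_log_mul_self_add_one_div :
    Tendsto (fun k : ℕ => Real.log ((k : ℝ) * k + 1) / k) atTop (𝓝 0) := by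
  have h1 : Tendsto (fun k : ℕ => 2 * (Real.log ((k : ℝ) + 1) / ((k : ℝ) + 1) * (1 + 1 / (k : ℝ))))
      atTop (𝓝 (2 * (0 * (1 + 0)))) := by
    refine Tendsto.const_mul _ (Tendsto.mul ?_ (tendsto_const_nhds.add
      tendsto_one_div_atTop_nhds_zero_nat))
    have := Real.isLittleO_log_id_atTop.tendsto_div_nhds_zero.comp
      (tendsto_atTop_add_const_right atTop (1 : ℝ) tendsto_natCast_atTop_atTop)
    exact this
  rw [zero_mul, mul_zero] at h1
  refine squeeze_zero' (Eventually.of_forall fun k => ?_) ?_ h1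
  · exact div_nonneg (Real.log_nonneg (by nlinarith [sq_nonneg (k : ℝ)])) k.cast_nonneg
  · filter_upwards [eventually_gt_atTop 0] with k hk
    have hk' : (0 : ℝ) < k := by exact_mod_cast hk
    have : Real.log ((k : ℝ) * k + 1) ≤ 2 * Real.log ((k : ℝ) + 1) := by
      rw [← Nat.cast_two, ← Real.log_pow]
      exact Real.log_le_log (by positivity) (by nlinarith)
    calc Real.log ((k : ℝ) * k + 1) / k ≤ 2 * Real.log ((k : ℝ) + 1) / k := by gcongr
      _ = _ := by field_simp

/-- The entropies of the shift spaces between `Y` and `X` are dense. -/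
theorem IsFactorCode.exists_isLocal_entropy_near {A B : Type*}
    [TopologicalSpace A] [DiscreteTopology A] [Finite A]
    [TopologicalSpace B] [DiscreteTopology B] [Finite B]
    {X : Subshift A ℤ} {Y : Subshift B ℤ} {φ : X.carrier → Y.carrier} (hφ : IsFactorCode φ)
    {t : ℝ} (ht : t ∈ Set.Icc (entropy Y) (entropy X)) {ε : ℝ} (hε : 0 < ε) :
    ∃ (c : ℕ) (f : X.carrier → ℤ → Fin c) (hf : IsLocal f) (π : Fin c → B),
      (∀ x i, (φ x).1 i = π (f x i)) ∧ t ≤ entropy (rangeShift f hf) ∧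
        entropy (rangeShift f hf) ≤ t + ε := by
  have hloc := hφ.toIsCode.isLocal
  obtain ⟨k, hkε, hk⟩ := ((tendsto_log_mul_self_add_one_div.eventually_lt_const hε).and
    (eventually_gt_atTop 0)).exists
  obtain ⟨M, ⟨idx⟩⟩ := Finite.exists_equiv_fin (Fin k → A)
  obtain ⟨c, ⟨e⟩⟩ := Finite.exists_equiv_fin (B × Fin (M + 1))
  let wd : X.carrier → ℤ → Fin k → A := fun x i t => x.1 (i + 0 + t)
  have hwd : IsLocal wd := isLocal_block X k 0
  -- Truncation at `j` identifies all indices from `j` on, so exactly the first `j` words are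
  -- revealed.
  let cut : ℕ → Fin M → Fin (M + 1) := fun j a =>
    ⟨min a j, (min_le_left _ _).trans_lt (a.2.trans (Nat.lt_succ_self M))⟩
  let F : ℕ → X.carrier → ℤ → Fin c := fun j x i => e ((φ x).1 i, cut j (idx (wd x i)))
  have hF : ∀ j, IsLocal (F j) := fun j =>
    (hloc.prodMk (hwd.map fun w => cut j (idx w))).map e
  let H : ℕ → ℝ := fun j => entropy (rangeShift (F j) (hF j))
  have h0 : H 0 ≤ entropy Y := by
    have := entropy_le_of_determines (hF 0) hloc (Z := rangeShift (F 0) (hF 0)) rfl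
      hφ.carrier_eq_range 0 0 0 fun n => ⟨Unit, inferInstance, fun _ => (), fun x x' hxx _ i h1 h2 =>
        by
          have := hxx i (by omega) (by omega)
          simp [F, cut, this], by simp⟩
    simpa using this
  have hM : entropy X ≤ H M := by
    have := entropy_le_of_determines (isLocal_val X) (hF M) Subtype.range_val.symm
      (Y := rangeShift (F M) (hF M)) rfl 0 0 0
      fun n => ⟨Unit, inferInstance, fun _ => (), fun x x' hxx _ i h1 h2 => by
        have h3 := congrArg Prod.snd (e.injective (hxx i (by omega) (by omega)))
        have h4 : min (idx (wd x i) : ℕ) M = min (idx (wd x' i) : ℕ) M := congrArg Fin.val h3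
        rw [min_eq_left (idx (wd x i)).2.le, min_eq_left (idx (wd x' i)).2.le] at h4
        have h5 := congrFun (idx.injective (Fin.ext h4)) ⟨0, hk⟩
        simpa [wd] using h5, by simp⟩
    simpa using this
  have hstep : ∀ j, H (j + 1) ≤ H j + ε := by
    intro j
    by_cases hj : j < M
    · have := entropy_le_of_determines_occursAt (hF (j + 1)) (hF j)
        (Z := rangeShift (F (j + 1)) (hF (j + 1))) rfl (Y := rangeShift (F j) (hF j)) rfl hk
        (idx.symm ⟨j, hj⟩) (by
          intro x x' i hx hocc
          obtain ⟨hx1, hx2⟩ := Prod.ext_iff.mp (e.injective hx)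
          have hx3 : min (idx (wd x i) : ℕ) j = min (idx (wd x' i) : ℕ) j := congrArg Fin.val hx2
          have ho : ∀ x : X.carrier, OccursAt (idx.symm ⟨j, hj⟩) x.1 i ↔
              (idx (wd x i) : ℕ) = j := by
            intro x
            have h1 : OccursAt (idx.symm ⟨j, hj⟩) x.1 i ↔ wd x i = idx.symm ⟨j, hj⟩ := by
              rw [funext_iff]
              simp [wd, OccursAt]
            rw [h1, Equiv.eq_symm_apply, Fin.ext_iff]
          rw [ho, ho] at hocc
          refine congrArg e (Prod.ext hx1 (Fin.ext ?_))
          change min (idx (wd x i) : ℕ) (j + 1) = min (idx (wd x' i) : ℕ) (j + 1)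
          omega)
      exact this.trans (by linarith)
    · have := entropy_le_of_determines (hF (j + 1)) (hF j)
        (Z := rangeShift (F (j + 1)) (hF (j + 1))) rfl (Y := rangeShift (F j) (hF j)) rfl 0 0 0
        fun n => ⟨Unit, inferInstance, fun _ => (), fun x x' hxx _ i h1 h2 => by
          have hx := hxx i (by omega) (by omega)
          obtain ⟨hx1, hx2⟩ := Prod.ext_iff.mp (e.injective hx)
          have hx3 : min (idx (wd x i) : ℕ) j = min (idx (wd x' i) : ℕ) j := congrArg Fin.val hx2
          refine congrArg e (Prod.ext hx1 (Fin.ext ?_))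
          change min (idx (wd x i) : ℕ) (j + 1) = min (idx (wd x' i) : ℕ) (j + 1)
          have h4 := (idx (wd x i)).2
          have h5 := (idx (wd x' i)).2
          omega, by simp⟩
      have h' : H (j + 1) ≤ H j + 0 := this
      linarith
  -- Discrete intermediate value: the first `H j` to reach `t` is at most `ε` above its predecessor,
  -- which is below `t`.
  have hex : ∃ j, t ≤ H j := ⟨M, ht.2.trans hM⟩
  classical
  have hfst := Nat.find_spec hex
  have hupper : H (Nat.find hex) ≤ t + ε := by
    rcases h : Nat.find hex with _ | j
    · exact h0.trans (ht.1.trans (by linarith))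
    · have hlt : ¬ t ≤ H j := Nat.find_min hex (by omega)
      have := hstep j
      linarith
  refine ⟨c, F (Nat.find hex), hF _, fun a => (e.symm a).1, fun x i => ?_, hfst, hupper⟩
  simp [F]

/-! ### Markers -/

/-- Krieger's marker lemma: there is a local rule marking positions at mutual distance at least `N`
such that around unmarked positions the sequence has a period smaller than `N`. -/
theorem exists_marker (C : Type*) [Finite C] (N n : ℕ) (hN : 0 < N) :
    ∃ (F : (ℤ → C) → ℤ → Prop) (w : ℕ),
      (∀ (y y' : ℤ → C) (i i' : ℤ), (∀ j : ℤ, -w ≤ j → j ≤ w → y (i + j) = y' (i' + j)) →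
        (F y i ↔ F y' i')) ∧
      (∀ (y : ℤ → C) (i j : ℤ), F y i → F y j → i < j → i + N ≤ j) ∧
      ∀ (y : ℤ → C) (i : ℤ), (∀ j : ℤ, i - N < j → j < i + N → ¬ F y j) →
        ∃ p : ℕ, 0 < p ∧ p < N ∧ ∀ j : ℤ, i ≤ j → j + p < i + n → y j = y (j + p) := by
  -- Greedy choice: a word with a period below `N` is skipped; otherwise its occurrences at distance
  -- at least `N` from earlier markers are marked. Such a word has no self-overlap at distance below
  -- `N`, so separation persists.
  have hlist : ∀ l : List (Fin n → C), ∃ (F : (ℤ → C) → ℤ → Prop) (w : ℕ),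
      (∀ (y y' : ℤ → C) (i i' : ℤ), (∀ j : ℤ, -w ≤ j → j ≤ w → y (i + j) = y' (i' + j)) →
        (F y i ↔ F y' i')) ∧
      (∀ (y : ℤ → C) (i j : ℤ), F y i → F y j → i < j → i + N ≤ j) ∧
      ∀ (y : ℤ → C) (i : ℤ), (∀ j : ℤ, i - N < j → j < i + N → ¬ F y j) →
        ∀ v ∈ l, OccursAt v y i →
        ∃ p : ℕ, 0 < p ∧ p < N ∧ ∀ j : ℤ, i ≤ j → j + p < i + n → y j = y (j + p) := by
    intro l
    induction l with
    | nil => exact ⟨fun _ _ => False, 0, by simp, by simp, by simp⟩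
    | cons v l ih =>
      obtain ⟨F, w, hloc, hsep, hcov⟩ := ih
      by_cases hv : ∃ p : ℕ, 0 < p ∧ p < N ∧ ∀ s t : Fin n, (s : ℕ) + p = t → v s = v t
      · refine ⟨F, w, hloc, hsep, fun y i hi u hu ho => ?_⟩
        rcases List.mem_cons.mp hu with rfl | hu
        · obtain ⟨p, hp0, hpN, hp⟩ := hv
          refine ⟨p, hp0, hpN, fun j h1 h2 => ?_⟩
          have e1 := ho ⟨(j - i).toNat, by omega⟩
          have e2 := ho ⟨(j + p - i).toNat, by omega⟩
          simp only [Int.toNat_of_nonneg (show 0 ≤ j - i by omega),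
            Int.toNat_of_nonneg (show 0 ≤ j + p - i by omega), add_sub_cancel] at e1 e2
          rw [e1, e2]
          exact hp _ _ (by simp only; omega)
        · exact hcov y i hi u hu ho
      · refine ⟨fun y i => F y i ∨ (OccursAt v y i ∧ ∀ j : ℤ, i - N < j → j < i + N → ¬ F y j),
          w + N + n, ?_, ?_, ?_⟩
        · have key : ∀ (y y' : ℤ → C) (i i' : ℤ),
              (∀ j : ℤ, -(w + N + n : ℕ) ≤ j → j ≤ (w + N + n : ℕ) → y (i + j) = y' (i' + j)) →
              (F y i ∨ (OccursAt v y i ∧ ∀ j : ℤ, i - N < j → j < i + N → ¬ F y j)) →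
              (F y' i' ∨ (OccursAt v y' i' ∧ ∀ j : ℤ, i' - N < j → j < i' + N → ¬ F y' j)) := by
            intro y y' i i' h hF
            rcases hF with hF | ⟨ho, hn⟩
            · exact Or.inl ((hloc y y' i i' fun j h1 h2 =>
                h j (by push_cast; omega) (by push_cast; omega)).mp hF)
            · refine Or.inr ⟨fun t => ?_, fun j h1 h2 hFj => ?_⟩
              · rw [← h t (by push_cast; omega) (by push_cast; omega)]
                exact ho t
              · refine hn (i + (j - i')) (by omega) (by omega) ?_
                refine (hloc y y' _ j fun a h3 h4 => ?_).mpr hFj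
                have := h (j - i' + a) (by push_cast; omega) (by push_cast; omega)
                rw [show i + (j - i') + a = i + (j - i' + a) by ring, this]
                congr 1
                ring
          exact fun y y' i i' h => ⟨key y y' i i' h, key y' y i' i fun j h1 h2 => (h j h1 h2).symm⟩
        · rintro y i j (hi | ⟨hi, hni⟩) (hj | ⟨hj, hnj⟩) hij
          · exact hsep y i j hi hj hij
          · by_contra hlt
            exact hnj i (by omega) (by omega) hi
          · by_contra hlt
            exact hni j (by omega) (by omega) hj
          · by_contra hlt
            refine hv ⟨(j - i).toNat, by omega, by omega, fun s t hst => ?_⟩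
            rw [← hi t, ← hj s]
            congr 1
            omega
        · intro y i hi u hu ho
          have hi' : ∀ j : ℤ, i - N < j → j < i + N → ¬ F y j := fun j h1 h2 hF =>
            hi j h1 h2 (Or.inl hF)
          rcases List.mem_cons.mp hu with rfl | hu
          · exact absurd (Or.inr ⟨ho, hi'⟩) (hi i (by omega) (by omega))
          · exact hcov y i hi' u hu ho
  have := Fintype.ofFinite (Fin n → C)
  obtain ⟨F, w, hloc, hsep, hcov⟩ := hlist Finset.univ.toList
  exact ⟨F, w, hloc, hsep, fun y i hi => hcov y i hi (fun j => y (i + j)) (by simp) fun j => rfl⟩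

/-! ### Finite monoids and chains of sets -/

/-- Some power of every element of a finite monoid is idempotent, uniformly in the element. -/
theorem exists_pow_isIdempotentElem (M : Type*) [Monoid M] [Finite M] :
    ∃ q : ℕ, 0 < q ∧ ∀ g : M, IsIdempotentElem (g ^ q) := by
  have h1 : ∀ g : M, ∃ q : ℕ, 0 < q ∧ IsIdempotentElem (g ^ q) := by
    intro g
    obtain ⟨a, b, hab, h⟩ := Finite.exists_ne_map_eq_of_infinite fun n : ℕ => g ^ n
    wlog hlt : a < b generalizing a b
    · exact this b a hab.symm h.symm (by omega)
    obtain ⟨d, rfl⟩ := Nat.exists_eq_add_of_lt hlt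
    have hstep : ∀ m, a ≤ m → g ^ (m + (d + 1)) = g ^ m := by
      intro m hm
      obtain ⟨r, rfl⟩ := Nat.exists_eq_add_of_le hm
      have : a + r + (d + 1) = (a + d + 1) + r := by ring
      rw [this, pow_add, ← h, ← pow_add]
    have hmul : ∀ k m, a ≤ m → g ^ (m + k * (d + 1)) = g ^ m := by
      intro k
      induction k with
      | zero => simp
      | succ k ih =>
        intro m hm
        rw [show m + (k + 1) * (d + 1) = m + k * (d + 1) + (d + 1) by ring, hstep _ (by omega),
          ih m hm]
    -- A multiple of the eventual period `d + 1` beyond the preperiod `a`.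
    refine ⟨(a + 1) * (d + 1), by positivity, ?_⟩
    rw [IsIdempotentElem, ← pow_add]
    exact hmul (a + 1) _ (by nlinarith)
  choose q hq0 hq using h1
  have := Fintype.ofFinite M
  refine ⟨∏ g, q g, Finset.prod_pos fun g _ => hq0 g, fun g => ?_⟩
  obtain ⟨k, hk⟩ := Finset.dvd_prod_of_mem q (Finset.mem_univ g)
  rw [hk, pow_mul]
  exact (hq g).pow k

/-- Otherwise `S (2 * m)` would have at least `m` elements, absurd for `m = Nat.card K + 1`. -/
theorem exists_eq_add_two_of_monotone {K : Type*} [Finite K] (S : ℕ → Set K)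
    (h : ∀ k, k ≤ 2 * Nat.card K + 1 → S k ⊆ S (k + 1)) :
    ∃ k, k ≤ 2 * Nat.card K ∧ S (k + 2) = S k := by
  by_contra! hne
  have hcard : ∀ m, m ≤ Nat.card K + 1 → m ≤ (S (2 * m)).ncard := by
    intro m
    induction m with
    | zero => simp
    | succ m ih =>
      intro hm
      have hss : S (2 * m) ⊂ S (2 * m + 2) :=
        ((h _ (by omega)).trans (h _ (by omega))).ssubset_of_ne (hne _ (by omega)).symm
      have := Set.ncard_lt_ncard hss (Set.toFinite _)
      have := ih (by omega)
      rw [show 2 * (m + 1) = 2 * m + 2 by ring]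
      omega
  have h1 := hcard _ le_rfl
  have h2 : (S (2 * (Nat.card K + 1))).ncard ≤ Nat.card K := Set.ncard_le_card _
  omega

/-! ### Reachability between states -/

section Reach

variable {A C K : Type*} [TopologicalSpace A] {X : Subshift A ℤ}

/-- Points in the same state at some time can be exchanged from there on. -/
def Glues (f : X.carrier → ℤ → C) (s : X.carrier → ℤ → K) : Prop :=
  ∀ (x x' : X.carrier) (i : ℤ), s x i = s x' i → ∃ u : X.carrier,
    (∀ j ≤ i, s u j = s x j ∧ f u j = f x j) ∧ ∀ j, i ≤ j → s u j = s x' j ∧ f u j = f x' j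

/-- Some point with labels `y` in `[t, t')` goes from state `a` at time `t` to state `b` at
time `t'`. -/
def Reach (f : X.carrier → ℤ → C) (s : X.carrier → ℤ → K) (y : ℤ → C) (t t' : ℤ) (a b : K) :
    Prop :=
  ∃ x, s x t = a ∧ s x t' = b ∧ ∀ j, t ≤ j → j < t' → f x j = y j

variable {f : X.carrier → ℤ → C} {s : X.carrier → ℤ → K} {y y' : ℤ → C} {a b c : K}

theorem Reach.of_eq (x : X.carrier) {t t' : ℤ} (h : ∀ j, t ≤ j → j < t' → f x j = y j) :
    Reach f s y t t' (s x t) (s x t') :=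
  ⟨x, rfl, rfl, h⟩

theorem Reach.trans (hg : Glues f s) {t u v : ℤ} (htu : t ≤ u) (huv : u ≤ v)
    (h : Reach f s y t u a b) (h' : Reach f s y u v b c) : Reach f s y t v a c := by
  obtain ⟨x, h1, h2, h3⟩ := h
  obtain ⟨x', h1', h2', h3'⟩ := h'
  obtain ⟨z, hz, hz'⟩ := hg x x' u (h2.trans h1'.symm)
  refine ⟨z, (hz t htu).1.trans h1, (hz' v huv).1.trans h2', fun j hj1 hj2 => ?_⟩
  rcases lt_or_ge j u with hj | hj
  · exact (hz j hj.le).2.trans (h3 j hj1 hj)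
  · exact (hz' j hj).2.trans (h3' j hj hj2)

theorem Reach.exists_mid {t u v : ℤ} (htu : t ≤ u) (huv : u ≤ v) (h : Reach f s y t v a c) :
    ∃ b, Reach f s y t u a b ∧ Reach f s y u v b c := by
  obtain ⟨x, h1, h2, h3⟩ := h
  exact ⟨s x u, ⟨x, h1, rfl, fun j hj1 hj2 => h3 j hj1 (by omega)⟩,
    ⟨x, rfl, h2, fun j hj1 hj2 => h3 j (by omega) hj2⟩⟩

theorem Reach.translate (hf : IsLocal f) (hs : IsLocal s) {t t' u u' : ℤ} (hl : u' - u = t' - t)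
    (hy : ∀ j, t ≤ j → j < t' → y j = y' (u - t + j)) (h : Reach f s y t t' a b) :
    Reach f s y' u u' a b := by
  obtain ⟨x, h1, h2, h3⟩ := h
  refine ⟨shiftBy X (t - u) x, ?_, ?_, fun j hj1 hj2 => ?_⟩
  · rw [hs.map_shift, sub_add_cancel, h1]
  · rw [hs.map_shift, show t - u + u' = t' by omega, h2]
  · rw [hf.map_shift, h3 _ (by omega) (by omega), hy _ (by omega) (by omega)]
    congr 1
    ring

theorem Reach.congr {t t' : ℤ} (hy : ∀ j, t ≤ j → j < t' → y j = y' j)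
    (h : Reach f s y t t' a b) : Reach f s y' t t' a b := by
  obtain ⟨x, h1, h2, h3⟩ := h
  exact ⟨x, h1, h2, fun j hj1 hj2 => (h3 j hj1 hj2).trans (hy j hj1 hj2)⟩

theorem periodic_add_mul {i n : ℤ} {p : ℕ}
    (hp : ∀ j : ℤ, i ≤ j → j + p < i + n → y j = y (j + p)) (m : ℕ) :
    ∀ j : ℤ, i ≤ j → j + p * m < i + n → y j = y (j + p * m) := by
  induction m with
  | zero => simp
  | succ m ih =>
    intro j h1 h2
    push_cast at h2 ⊢
    have h0 : (0 : ℤ) ≤ p * m := by positivity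
    rw [ih j h1 (by nlinarith), hp _ (by omega) (by nlinarith)]
    congr 1
    ring

/-- Over a stretch of period `p`, the relation of reachability in time `P` is idempotent if `P` is
a suitable multiple of `p`. -/
theorem exists_reach_idempotent [Finite K] (hf : IsLocal f) (hs : IsLocal s) (hg : Glues f s) :
    ∃ q : ℕ, 0 < q ∧ ∀ (y : ℤ → C) (i n t : ℤ) (p m : ℕ) (a b : K), 0 < p → 0 < m → q ∣ m →
      (∀ j : ℤ, i ≤ j → j + p < i + n → y j = y (j + p)) → i ≤ t → t + 2 * (p * m) ≤ i + n →
      Reach f s y t (t + 2 * (p * m)) a b → Reach f s y t (t + p * m) a b := by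
  have : Finite (Function.End (Set K)) := inferInstanceAs (Finite (Set K → Set K))
  obtain ⟨q, hq0, hq⟩ := exists_pow_isIdempotentElem (Function.End (Set K))
  refine ⟨q, hq0, fun y i n t p m a b hp0 hm0 hqm hp hit htn h => ?_⟩
  -- Reachability over one period, acting on sets of states. By periodicity its powers are
  -- reachability over several periods.
  let g : Function.End (Set K) := fun S => {b | ∃ a ∈ S, Reach f s y t (t + p) a b}
  have hpow : ∀ k : ℕ, t + p * (k + 1) ≤ i + n → ∀ (S : Set K) (b : K),
      b ∈ (g ^ (k + 1)) S ↔ ∃ a ∈ S, Reach f s y t (t + p * (k + 1)) a b := by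
    intro k
    induction k with
    | zero =>
      intro _ S b
      rw [zero_add, pow_one, Nat.cast_zero, zero_add, mul_one]
      rfl
    | succ k ih =>
      intro hk S b
      push_cast at hk ⊢
      have h0 : (0 : ℤ) ≤ p * (k + 1) := by positivity
      have hexp : (p : ℤ) * (k + 1 + 1) = p * (k + 1) + p := by ring
      rw [hexp] at hk ⊢
      have hper : ∀ j : ℤ, t ≤ j → j < t + p → y j = y (t + p * (k + 1) - t + j) := by
        intro j h1 h2
        have := periodic_add_mul hp (k + 1) j (by omega) (by push_cast; omega)
        rw [this]
        push_cast
        congr 1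
        ring
      have hper' : ∀ j : ℤ, t + p * (k + 1) ≤ j → j < t + (p * (k + 1) + p) →
          y j = y (t - (t + p * (k + 1)) + j) := by
        intro j h1 h2
        rw [hper (t - (t + p * (k + 1)) + j) (by omega) (by omega)]
        congr 1
        ring
      have hstep : (g ^ (k + 1 + 1)) S = g ((g ^ (k + 1)) S) := by
        rw [pow_succ' g (k + 1)]
        rfl
      rw [hstep]
      constructor
      · rintro ⟨c, hc, hcb⟩
        obtain ⟨a, ha, hac⟩ := (ih (by omega) S c).mp hc
        exact ⟨a, ha, hac.trans hg (by omega) (by omega)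
          (hcb.translate hf hs (by ring) hper)⟩
      · rintro ⟨a, ha, hab⟩
        obtain ⟨c, hac, hcb⟩ := hab.exists_mid (u := t + p * (k + 1)) (by omega) (by omega)
        exact ⟨c, (ih (by omega) S c).mpr ⟨a, ha, hac⟩, hcb.translate hf hs (by ring) hper'⟩
  obtain ⟨r, rfl⟩ := hqm
  have hid : IsIdempotentElem (g ^ (q * r)) := by
    rw [pow_mul]
    exact (hq g).pow r
  obtain ⟨l, hl⟩ : ∃ l, q * r = l + 1 := ⟨q * r - 1, by omega⟩
  rw [hl] at hid htn h ⊢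
  push_cast at htn h ⊢
  have h0 : (0 : ℤ) ≤ p * (l + 1) := by positivity
  have hid' : g ^ (2 * l + 1 + 1) = g ^ (l + 1) := by
    rw [← hid.eq, ← pow_add]
    congr 1
    ring
  have h1 : b ∈ (g ^ (2 * l + 1 + 1)) {a} := by
    refine (hpow (2 * l + 1) ?_ {a} b).mpr ⟨a, rfl, ?_⟩
    · push_cast
      linarith
    · convert h using 1
      push_cast
      ring
  rw [hid'] at h1
  obtain ⟨_, rfl, h2⟩ := (hpow l (by omega) {a} b).mp h1
  exact h2

end Reach

/-! ### Revealed information and gluing -/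

section Reveal

variable {A C K : Type*} [TopologicalSpace A] {X : Subshift A ℤ}
  {f : X.carrier → ℤ → C} {s : X.carrier → ℤ → K} {F : (ℤ → C) → ℤ → Prop} {N P w : ℕ}

open Classical in
/-- The information revealed about the state `q` at time `i` over the label sequence `y`: the state
itself at the markers `F`, and far from the markers the set of states at time `i - P` from which
it can be reached. -/
def reveal (f : X.carrier → ℤ → C) (s : X.carrier → ℤ → K) (F : (ℤ → C) → ℤ → Prop) (N P : ℕ)
    (y : ℤ → C) (i : ℤ) (q : K) : Set K :=
  if F y i then {q}
  else if ∀ j : ℤ, i - N < j → j < i + N → ¬ F y j then {a | Reach f s y (i - P) i a q}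
  else ∅

theorem reveal_of_marked {y : ℤ → C} {i : ℤ} (h : F y i) (q : K) :
    reveal f s F N P y i q = {q} := if_pos h

theorem reveal_of_unmarked {y : ℤ → C} {i : ℤ} (hN : 0 < N)
    (h : ∀ j : ℤ, i - N < j → j < i + N → ¬ F y j) (q : K) :
    reveal f s F N P y i q = {a | Reach f s y (i - P) i a q} := by
  rw [reveal, if_neg (h i (by omega) (by omega)), if_pos h]

theorem reveal_congr_of_reach {y : ℤ → C} {i : ℤ} {q q' : K} (hm : ¬ F y i)
    (h : ∀ a, Reach f s y (i - P) i a q ↔ Reach f s y (i - P) i a q') :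
    reveal f s F N P y i q = reveal f s F N P y i q' := by
  simp only [reveal, if_neg hm, h]

/-- The test for nearby markers sees radius `w + N`, and paths look back `P`. -/
theorem reveal_congr (hf : IsLocal f) (hs : IsLocal s)
    (hF : ∀ (y y' : ℤ → C) (i i' : ℤ), (∀ j : ℤ, -w ≤ j → j ≤ w → y (i + j) = y' (i' + j)) →
      (F y i ↔ F y' i')) {y y' : ℤ → C} {i i' : ℤ}
    (h : ∀ j : ℤ, -(w + N + P : ℕ) ≤ j → j ≤ (w + N + P : ℕ) → y (i + j) = y' (i' + j)) (q : K) :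
    reveal f s F N P y i q = reveal f s F N P y' i' q := by
  push_cast at h
  have hF' : ∀ a : ℤ, -N ≤ a → a ≤ N → (F y (i + a) ↔ F y' (i' + a)) := fun a h1 h2 =>
    hF y y' _ _ fun j h3 h4 => by
      simpa only [add_assoc] using h (a + j) (by omega) (by omega)
  have h0 : F y i ↔ F y' i' := by simpa using hF' 0 (by omega) (by omega)
  have hU : (∀ j : ℤ, i - N < j → j < i + N → ¬ F y j) ↔
      ∀ j : ℤ, i' - N < j → j < i' + N → ¬ F y' j := by
    constructor
    · intro hu j h1 h2 hj
      refine hu (i + (j - i')) (by omega) (by omega) ((hF' (j - i') (by omega) (by omega)).mpr ?_)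
      rwa [add_sub_cancel]
    · intro hu j h1 h2 hj
      refine hu (i' + (j - i)) (by omega) (by omega) ((hF' (j - i) (by omega) (by omega)).mp ?_)
      rwa [add_sub_cancel]
  have hR : {a | Reach f s y (i - P) i a q} = {a | Reach f s y' (i' - P) i' a q} := by
    ext a
    constructor
    · refine fun hr => hr.translate hf hs (by ring) fun j h1 h2 => ?_
      have := h (j - i) (by omega) (by omega)
      rw [add_sub_cancel] at this
      rw [this]
      congr 1
      ring
    · refine fun hr => hr.translate hf hs (by ring) fun j h1 h2 => ?_
      have := h (j - i') (by omega) (by omega)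
      rw [add_sub_cancel] at this
      rw [← this]
      congr 1
      ring
  classical
  unfold reveal
  rw [hR]
  exact if_congr h0 rfl (if_congr hU rfl rfl)

theorem isLocal_reveal (hf : IsLocal f) (hs : IsLocal s)
    (hF : ∀ (y y' : ℤ → C) (i i' : ℤ), (∀ j : ℤ, -w ≤ j → j ≤ w → y (i + j) = y' (i' + j)) →
      (F y i ↔ F y' i')) :
    IsLocal fun (x : X.carrier) (i : ℤ) => reveal f s F N P (f x) i (s x i) := by
  obtain ⟨m, hm⟩ := hf.window
  obtain ⟨n, hn⟩ := hs.window
  refine ⟨fun k x i => ?_, m + n + (w + N + P), fun x x' i h => ?_⟩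
  · rw [hs.map_shift]
    exact reveal_congr hf hs hF (fun j _ _ => by rw [hf.map_shift, add_assoc]) _
  · rw [Nat.cast_add, Nat.cast_add] at h
    rw [hn x x' i fun j h1 h2 => h j (by omega) (by omega)]
    exact reveal_congr hf hs hF (fun j h1 h2 => hm x x' _ fun a h3 h4 =>
      h a (by omega) (by omega)) _

/-- Two points are glued along a connecting path on `[t, t']` that reveals the same information. -/
theorem exists_glue_of_path (hf : IsLocal f) (hs : IsLocal s) (hg : Glues f s)
    (hF : ∀ (y y' : ℤ → C) (i i' : ℤ), (∀ j : ℤ, -w ≤ j → j ≤ w → y (i + j) = y' (i' + j)) →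
      (F y i ↔ F y' i')) {x x' v : X.carrier} {l r t t' : ℤ}
    (hxx' : ∀ i, l ≤ i → i < r → f x i = f x' i ∧
      reveal f s F N P (f x) i (s x i) = reveal f s F N P (f x') i (s x' i))
    (hlt : l + (w + N + P : ℕ) ≤ t) (htt' : t ≤ t') (htr : t' + (w + N + P : ℕ) < r)
    (hvt : s v t = s x t) (hvt' : s v t' = s x' t') (hvx : ∀ j, t ≤ j → j < t' → f v j = f x j)
    (hmid : ∀ j, t < j → j < t' →
      reveal f s F N P (f x) j (s v j) = reveal f s F N P (f x) j (s x j)) :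
    ∃ u : X.carrier,
      (∀ i, i < r → f u i = f x i ∧
        reveal f s F N P (f u) i (s u i) = reveal f s F N P (f x) i (s x i)) ∧
      ∀ i, l ≤ i → f u i = f x' i ∧
        reveal f s F N P (f u) i (s u i) = reveal f s F N P (f x') i (s x' i) := by
  -- `u` follows `x` up to `t`, then `v` up to `t'`, then `x'`. The margins ensure that the window
  -- of `reveal` sees labels of `x` before `t'` and of `x'` after.
  obtain ⟨u₁, hu1, hu1'⟩ := hg x v t hvt.symm
  obtain ⟨u, hu, hu'⟩ := hg u₁ x' t' ((hu1' t' htt').1.trans hvt')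
  have hfx : ∀ i, i < r → f u i = f x i := by
    intro i hi
    rcases lt_or_ge i t' with h | h
    · rw [(hu i h.le).2]
      rcases lt_or_ge i t with h' | h'
      · exact (hu1 i h'.le).2
      · exact (hu1' i h').2.trans (hvx i h' h)
    · rw [(hu' i h).2, (hxx' i (by omega) hi).1]
  have hfx' : ∀ i, l ≤ i → f u i = f x' i := by
    intro i hi
    rcases lt_or_ge i t' with h | h
    · rw [hfx i (by omega), (hxx' i hi (by omega)).1]
    · exact (hu' i h).2
  have hright : ∀ i, t' ≤ i →
      reveal f s F N P (f u) i (s u i) = reveal f s F N P (f x') i (s x' i) := by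
    intro i hi
    rw [(hu' i hi).1]
    exact reveal_congr hf hs hF (fun j h1 h2 => hfx' _ (by omega)) _
  have hleft : ∀ i, i < r →
      reveal f s F N P (f u) i (s u i) = reveal f s F N P (f x) i (s x i) := by
    intro i hi
    rcases lt_or_ge i t' with h | h
    · have hc := reveal_congr hf hs hF (N := N) (P := P) (y := f u) (y' := f x) (i := i) (i' := i)
        (fun j h1 h2 => hfx _ (by omega))
      rw [hc, (hu i h.le).1]
      rcases le_or_gt i t with h' | h'
      · rw [(hu1 i h').1]
      · rw [(hu1' i h'.le).1]
        exact hmid i h' h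
    · rw [hright i h, (hxx' i (by omega) hi).2]
  refine ⟨u, fun i hi => ⟨hfx i hi, hleft i hi⟩, fun i hi => ⟨hfx' i hi, ?_⟩⟩
  rcases lt_or_ge i r with h | h
  · rw [hleft i h, (hxx' i hi h).2]
  · exact hright i (by omega)

/-- Points that reveal the same information along a long window can be glued. -/
theorem exists_marker_glue [Finite C] [Finite K] (hf : IsLocal f) (hs : IsLocal s)
    (hg : Glues f s) (hN : 0 < N) :
    ∃ Q : ℕ, 0 < Q ∧ ∀ P : ℕ, 0 < P → Q ∣ P → ∃ (F : (ℤ → C) → ℤ → Prop) (w : ℕ),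
      (∀ (y y' : ℤ → C) (i i' : ℤ), (∀ j : ℤ, -w ≤ j → j ≤ w → y (i + j) = y' (i' + j)) →
        (F y i ↔ F y' i')) ∧
      (∀ (y : ℤ → C) (i j : ℤ), F y i → F y j → i < j → i + N ≤ j) ∧
      ∃ W : ℕ, 0 < W ∧ ∀ (x x' : X.carrier) (l : ℤ),
        (∀ i, l ≤ i → i < l + W → f x i = f x' i ∧
          reveal f s F N P (f x) i (s x i) = reveal f s F N P (f x') i (s x' i)) →
        ∃ u : X.carrier,
          (∀ i, i < l + W → f u i = f x i ∧
            reveal f s F N P (f u) i (s u i) = reveal f s F N P (f x) i (s x i)) ∧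
          ∀ i, l ≤ i → f u i = f x' i ∧
            reveal f s F N P (f u) i (s u i) = reveal f s F N P (f x') i (s x' i) := by
  obtain ⟨q, hq0, hq⟩ := exists_reach_idempotent hf hs hg
  -- `N!` makes `P` a multiple of every period below `N`, and `q` makes the quotient a multiple of
  -- `q`.
  refine ⟨q * N.factorial, Nat.mul_pos hq0 N.factorial_pos, fun P hP hQP => ?_⟩
  -- The chain below repeats at some `k ≤ 2 * Nat.card K`, and the paths used end by step `k + 4`.
  set n := (2 * Nat.card K + 4) * P with hn
  obtain ⟨F, w, hF, hsep, hcov⟩ := exists_marker C N n hN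
  -- The window has a margin `w + N + P` at each end and, inside, a strip of width `N` on each side
  -- of the periodic stretch.
  refine ⟨F, w, hF, hsep, 2 * (w + N + P) + 2 * N + n + 1, by omega, fun x x' l hxx' => ?_⟩
  set V := w + N + P with hV
  push_cast at hxx' ⊢
  by_cases hmark : ∃ i : ℤ, l + V ≤ i ∧ i < l + V + 2 * N + n + 1 ∧ F (f x) i
  · obtain ⟨i, h1, h2, hi⟩ := hmark
    have hi' : F (f x') i :=
      (hF _ _ i i fun j h3 h4 => (hxx' (i + j) (by omega) (by omega)).1).mp hi
    have h := (hxx' i (by omega) (by omega)).2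
    rw [reveal_of_marked hi, reveal_of_marked hi', Set.singleton_eq_singleton_iff] at h
    -- At a common marker the states agree, and the empty path suffices.
    exact exists_glue_of_path hf hs hg hF hxx' h1 le_rfl (by omega) rfl h
      (fun j h3 h4 => by omega) fun j h3 h4 => by omega
  · push Not at hmark
    set i₀ : ℤ := l + V + N with hi₀
    obtain ⟨p, hp0, hpN, hp⟩ := hcov (f x) i₀ fun j h1 h2 => hmark j (by omega) (by omega)
    obtain ⟨m, hPm, hm0, hqm⟩ : ∃ m, P = p * m ∧ 0 < m ∧ q ∣ m := by
      obtain ⟨a, ha⟩ := hQP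
      obtain ⟨b, hb⟩ := Nat.dvd_factorial hp0 hpN.le
      refine ⟨q * b * a, by rw [ha, hb]; ring, ?_, ⟨b * a, by ring⟩⟩
      refine Nat.pos_of_ne_zero fun h0 => hP.ne' ?_
      rw [ha, hb, show q * (p * b) * a = p * (q * b * a) by ring, h0, mul_zero]
    have hn' : (n : ℤ) = (2 * Nat.card K + 4) * P := by rw [hn]; push_cast; ring
    have hPm' : (P : ℤ) = p * m := by exact_mod_cast hPm
    set y := f x with hy
    have hcl : ∀ (t : ℤ) (a b : K), i₀ ≤ t → t + 2 * P ≤ i₀ + n →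
        Reach f s y t (t + 2 * P) a b → Reach f s y t (t + P) a b := by
      intro t a b h1 h2
      rw [hPm'] at h2 ⊢
      exact hq y i₀ n t p m a b hp0 hm0 hqm hp h1 h2
    have hper : ∀ r : ℕ, ∀ j : ℤ, i₀ ≤ j → j + P * r < i₀ + n → y j = y (j + P * r) := by
      intro r j h1 h2
      have := periodic_add_mul hp (m * r) j h1
      push_cast at this
      rw [← mul_assoc, ← hPm'] at this
      exact this h2
    have htr : ∀ (r : ℕ) (t t' : ℤ) (a b : K), i₀ ≤ t → t' + P * r ≤ i₀ + n →
        (Reach f s y t t' a b ↔ Reach f s y (t + P * r) (t' + P * r) a b) := by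
      intro r t t' a b h1 h2
      have h0 : (0 : ℤ) ≤ P * r := by positivity
      constructor
      · refine fun h => h.translate hf hs (by ring) fun j h3 h4 => ?_
        rw [hper r j (by omega) (by omega)]
        congr 1
        ring
      · refine fun h => h.translate hf hs (by ring) fun j h3 h4 => ?_
        rw [hper r (t - (t + P * r) + j) (by omega) (by omega)]
        congr 1
        ring
    have hrev : ∀ j : ℤ, i₀ ≤ j → j ≤ i₀ + n → ∀ c : K,
        (Reach f s y (j - P) j c (s x j) ↔ Reach f s y (j - P) j c (s x' j)) := by
      intro j h1 h2 c
      have h := (hxx' j (by omega) (by omega)).2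
      have hu : ∀ a : ℤ, j - N < a → a < j + N → ¬ F y a := fun a h3 h4 =>
        hmark a (by omega) (by omega)
      rw [← reveal_congr hf hs hF (y := y) (i := j) (fun a h3 h4 =>
        (hxx' (j + a) (by omega) (by omega)).1), reveal_of_unmarked hN hu,
        reveal_of_unmarked hN hu] at h
      exact Set.ext_iff.mp h c
    have hself : ∀ t t' : ℤ, Reach f s y t t' (s x t) (s x t') := fun t t' =>
      Reach.of_eq x fun j _ _ => rfl
    have hP' : (0 : ℤ) < P := by exact_mod_cast hP
    have hbd : ∀ k : ℕ, k ≤ 2 * Nat.card K + 4 → (P : ℤ) * k ≤ n := by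
      intro k hk
      rw [hn', mul_comm]
      exact mul_le_mul_of_nonneg_right (by exact_mod_cast hk) hP'.le
    -- Predecessors of `x` along the stretch. A predecessor at one step reaches `x` one step later
    -- in time `2 * P`, hence in time `P`; so the sets increase.
    let S : ℕ → Set K := fun k =>
      {c | Reach f s y (i₀ + P * k) (i₀ + P * k + P) c (s x (i₀ + P * k + P))}
    obtain ⟨k, hk, hSk⟩ := exists_eq_add_two_of_monotone S (by
      intro k hk c hc
      have h0 : (0 : ℤ) ≤ P * k := by positivity
      have h3 := hbd (k + 3) (by omega)
      push_cast at h3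
      rw [mul_add] at h3
      have h1 : Reach f s y (i₀ + P * k) (i₀ + P * k + 2 * P) c (s x (i₀ + P * k + 2 * P)) :=
        Reach.trans hg (u := i₀ + P * k + P) (by omega) (by omega) hc (hself _ _)
      have h2 := (htr 1 _ _ _ _ (by omega) (by push_cast; omega)).mp
        (hcl _ _ _ (by omega) (by omega) h1)
      change Reach f s y (i₀ + P * (k + 1 : ℕ)) (i₀ + P * (k + 1 : ℕ) + P) c
        (s x (i₀ + P * (k + 1 : ℕ) + P))
      convert h2 using 1 <;> push_cast
      · ring
      · ring
      · congr 1
        ring)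
    have h0 : (0 : ℤ) ≤ P * k := by positivity
    have h4 := hbd (k + 4) (by omega)
    push_cast at h4
    rw [mul_add] at h4
    obtain ⟨τ, hτ⟩ : ∃ τ : ℤ, τ = i₀ + P * k + P := ⟨_, rfl⟩
    -- Stabilisation goes back in time: up to translation, whatever leads to `x` at `τ + 2 * P`
    -- leads to `x` at `τ`.
    have hcol : ∀ c, Reach f s y (τ + P) (τ + 2 * P) c (s x (τ + 2 * P)) →
        Reach f s y (τ - P) τ c (s x τ) := by
      intro c hc
      have h5 : c ∈ S (k + 2) := by
        change Reach f s y (i₀ + P * (k + 2 : ℕ)) (i₀ + P * (k + 2 : ℕ) + P) c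
          (s x (i₀ + P * (k + 2 : ℕ) + P))
        have e1 : i₀ + P * ((k + 2 : ℕ) : ℤ) = τ + P := by rw [hτ]; push_cast; ring
        rw [e1, show τ + P + P = τ + 2 * P by ring]
        exact hc
      rw [hSk] at h5
      have h6 : Reach f s y (i₀ + P * k) (i₀ + P * k + P) c (s x (i₀ + P * k + P)) := h5
      rw [← hτ, show i₀ + P * (k : ℤ) = τ - P by rw [hτ]; ring] at h6
      exact h6
    have hself' : ∀ t t' : ℤ, i₀ ≤ t → t' ≤ i₀ + n → Reach f s y t t' (s x' t) (s x' t') :=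
      fun t t' h1 h2 => Reach.of_eq x' fun j h3 h4 => (hxx' j (by omega) (by omega)).1.symm
    have ha : Reach f s y (τ - P) τ (s x (τ + P)) (s x τ) := hcol _ (hself _ _)
    have hb : Reach f s y (τ - P) τ (s x' (τ + P)) (s x τ) := by
      refine hcol _ ?_
      have := (hrev (τ + 2 * P) (by omega) (by omega) (s x' (τ + P))).mpr
      rw [show τ + 2 * P - P = τ + (P : ℤ) by ring] at this
      exact this (hself' _ _ (by omega) (by omega))
    -- The connecting path: at `τ + P` the points `x` and `x'` have the same predecessors, one of
    -- which is the state of `x` at `τ`.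
    have hab : Reach f s y τ (τ + P) (s x τ) (s x' (τ + P)) := by
      have := (hrev (τ + P) (by omega) (by omega) (s x τ)).mp
      rw [add_sub_cancel_right] at this
      exact this (hself _ _)
    -- `d'` leads to `d` through `e` and the state of `x` at `τ` in time `2 * P`, hence `P`, so
    -- predecessors of `d'` precede `d`. Used both ways, this equates the predecessors of `v` and
    -- `x` at `j`.
    have hdir : ∀ (j : ℤ) (c d d' e : K), τ < j → j < τ + P → Reach f s y τ j (s x τ) d →
        Reach f s y j (τ + P) d' e → Reach f s y (τ - P) τ e (s x τ) →
        Reach f s y (j - P) j c d' → Reach f s y (j - P) j c d := by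
      intro j c d d' e h1 h2 hd hd' he hc
      have he2 := (htr 2 _ _ _ _ (by omega) (by push_cast; omega)).mp he
      have hd2 := (htr 2 _ _ _ _ (by omega) (by push_cast; omega)).mp hd
      rw [Nat.cast_two, show τ - (P : ℤ) + P * 2 = τ + P by ring] at he2
      rw [Nat.cast_two] at hd2
      have h5 : Reach f s y j (j + P * 2) d' d :=
        Reach.trans hg (by omega) (by omega) hd'
          (Reach.trans hg (by omega) (by omega) he2 hd2)
      rw [show j + (P : ℤ) * 2 = j + 2 * P by ring] at h5
      have h6 := hcl _ _ _ (by omega) (by omega) h5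
      have h7 : Reach f s y (j - P) (j - P + 2 * P) c d := by
        rw [show j - (P : ℤ) + 2 * P = j + P by ring]
        exact Reach.trans hg (by omega) (by omega) hc h6
      have h8 := hcl _ _ _ (by omega) (by omega) h7
      rwa [sub_add_cancel] at h8
    obtain ⟨v, hv1, hv2, hv3⟩ := hab
    refine exists_glue_of_path hf hs hg hF hxx' (t := τ) (t' := τ + P) (v := v) (by omega)
      (by omega) (by omega) hv1 hv2 hv3 fun j h1 h2 => ?_
    refine reveal_congr_of_reach (hmark j (by omega) (by omega)) fun c => ?_
    have hvj : Reach f s y τ j (s x τ) (s v j) := ⟨v, hv1, rfl, fun i h3 h4 => hv3 i h3 (by omega)⟩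
    have hvj' : Reach f s y j (τ + P) (s v j) (s x' (τ + P)) :=
      ⟨v, rfl, hv2, fun i h3 h4 => hv3 i (by omega) h4⟩
    exact ⟨hdir j c _ _ _ h1 h2 (hself _ _) hvj' hb, hdir j c _ _ _ h1 h2 hvj (hself _ _) ha⟩

end Reveal

/-! ### Entropy cost of the revealed information -/

/-- The value `P` encodes that `p` is never entered before time `P`. -/
theorem exists_entry_time (P : ℕ) (p : ℕ → Prop) (hp : ∀ i j, i ≤ j → p i → p j) :
    ∃ r : Fin (P + 1), ∀ i, i < P → (p i ↔ (r : ℕ) ≤ i) := by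
  classical
  by_cases h : ∃ i, p i ∧ i < P
  · have h1 := Nat.find_spec h
    refine ⟨⟨Nat.find h, by omega⟩, fun i hi => ⟨fun hpi => Nat.find_min' h ⟨hpi, hi⟩, fun hle =>
      hp _ _ hle h1.1⟩⟩
  · push Not at h
    refine ⟨Fin.last P, fun i hi => ⟨fun hpi => absurd hi (by have := h i hpi; omega), ?_⟩⟩
    intro hle
    simp only [Fin.val_last] at hle
    omega

theorem exists_block_eq {k n : ℕ} (hk : 0 < k) {i : ℤ} (h0 : 0 ≤ i) (hn : i < n) :
    ∃ (b : Fin (n / k + 1)) (r : ℕ), r < k ∧ i = (b : ℕ) * k + r := by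
  obtain ⟨i, rfl⟩ := Int.eq_ofNat_of_zero_le h0
  refine ⟨⟨i / k, Nat.lt_succ_of_le (Nat.div_le_div_right (by omega))⟩, i % k, Nat.mod_lt i hk, ?_⟩
  exact_mod_cast (Nat.div_add_mod' i k).symm

section Reveal

variable {A C K : Type*} [TopologicalSpace A] {X : Subshift A ℤ}
  {f : X.carrier → ℤ → C} {s : X.carrier → ℤ → K} {F : (ℤ → C) → ℤ → Prop} {N P w : ℕ}

/-- The revealed information has a small entropy. -/
theorem entropy_le_of_reveal {D E : Type*} [Finite K]
    [TopologicalSpace D] [Finite D] [TopologicalSpace E] [Finite E] {Z : Subshift D ℤ}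
    {Y : Subshift E ℤ} {g : X.carrier → ℤ → D} {f' : X.carrier → ℤ → E}
    (hf : IsLocal f) (hs : IsLocal s) (hg : Glues f s)
    (hF : ∀ (y y' : ℤ → C) (i i' : ℤ), (∀ j : ℤ, -w ≤ j → j ≤ w → y (i + j) = y' (i' + j)) →
      (F y i ↔ F y' i'))
    (hsep : ∀ (y : ℤ → C) (i j : ℤ), F y i → F y j → i < j → i + N ≤ j) (hN : 0 < N) (hP : 0 < P)
    (hf' : IsLocal f') (hgl : IsLocal g) (hZ : Z.carrier = Set.range g)
    (hY : Y.carrier = Set.range f')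
    (hff' : ∀ x x' i, f' x i = f' x' i → f x i = f x' i)
    (hgdet : ∀ x x' i, f' x i = f' x' i →
      reveal f s F N P (f x) i (s x i) = reveal f s F N P (f x') i (s x' i) → g x i = g x' i) :
    entropy Z ≤ entropy Y + (Nat.card K * (Real.log ((P : ℝ) * P + 1) / P) +
      Real.log (Nat.card K + 1) / N) := by
  set κ := Nat.card K
  have hP1 : (1 : ℝ) ≤ (P : ℝ) + 1 := by simp
  refine entropy_le_of_determines hgl hf' hZ hY (w + N + P) _
    (Real.log (((P : ℝ) + 1) ^ κ) + Real.log ((κ : ℝ) + 1)) fun n => ?_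
  -- A state at the block start that reaches `x` once does so for the rest of the block, by
  -- following `x`.
  choose r hr using fun (x : X.carrier) (b : Fin (n / P + 1)) (a : K) =>
    exists_entry_time P
      (fun i : ℕ => Reach f s (f x) ((b : ℕ) * P) ((b : ℕ) * P + i) a (s x ((b : ℕ) * P + i)))
      fun i j hij h => h.trans hg (by omega) (by omega) (Reach.of_eq x fun _ _ _ => rfl)
  -- Separation allows at most one marker per block of length `N`.
  have hmark : ∀ (x : X.carrier) (b : Fin (n / N + 1)), ∃ o : Option K, ∀ i : ℕ, i < N →
      F (f x) ((b : ℕ) * N + i) → o = some (s x ((b : ℕ) * N + i)) := by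
    intro x b
    by_cases h : ∃ i : ℕ, i < N ∧ F (f x) ((b : ℕ) * N + i)
    · obtain ⟨i, hi, hFi⟩ := h
      refine ⟨some (s x ((b : ℕ) * N + i)), fun j hj hFj => ?_⟩
      rcases lt_trichotomy i j with h | h | h
      · have := hsep _ _ _ hFi hFj (by omega)
        omega
      · rw [h]
      · have := hsep _ _ _ hFj hFi (by omega)
        omega
    · push Not at h
      exact ⟨none, fun i hi hFi => absurd hFi (h i hi)⟩
  choose o ho using hmark
  obtain ⟨κ', ⟨eK⟩⟩ := Finite.exists_equiv_fin K
  have hκ : κ = κ' := by simp [κ, Nat.card_congr eK]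
  refine ⟨(Fin (n / P + 1) → Fin κ' → Fin (P + 1)) × (Fin (n / N + 1) → Option (Fin κ')),
    inferInstance, fun x => (fun b a => r x b (eK.symm a), fun b => (o x b).map eK), ?_, ?_⟩
  · intro x x' hxx' hd i h0 hn
    obtain ⟨hd1, hd2⟩ := Prod.ext_iff.mp hd
    have hr' : ∀ b a, r x b a = r x' b a := fun b a => by
      simpa using congrFun (congrFun hd1 b) (eK a)
    have ho' : ∀ b, o x b = o x' b := fun b =>
      Option.map_injective eK.injective (congrFun hd2 b)
    have hfx : ∀ j : ℤ, i - (w + N + P : ℕ) ≤ j → j ≤ i + (w + N + P : ℕ) → f x j = f x' j :=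
      fun j h1 h2 => hff' _ _ _ (hxx' j (by omega) (by omega))
    refine hgdet x x' i (hxx' i (by omega) (by omega)) ?_
    rw [← reveal_congr hf hs hF (y := f x) (y' := f x') (i := i) (i' := i)
      (fun j h1 h2 => hfx _ (by omega) (by omega))]
    push_cast at hfx
    by_cases hFi : F (f x) i
    · have hFi' : F (f x') i :=
        (hF _ _ i i fun j h1 h2 => hfx _ (by omega) (by omega)).mp hFi
      obtain ⟨b, t, ht, rfl⟩ := exists_block_eq hN h0 hn
      have h1 := ho x b t ht hFi
      have h2 := ho x' b t ht hFi'
      rw [ho', h2, Option.some_inj] at h1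
      rw [h1]
    -- A path of length `P` ending in a block passes through its start, where the entry times
    -- decide.
    · refine reveal_congr_of_reach hFi fun c => ?_
      obtain ⟨b, t, ht, rfl⟩ := exists_block_eq hP h0 hn
      have key : ∀ a, Reach f s (f x) ((b : ℕ) * P) ((b : ℕ) * P + t) a (s x ((b : ℕ) * P + t)) ↔
          Reach f s (f x) ((b : ℕ) * P) ((b : ℕ) * P + t) a (s x' ((b : ℕ) * P + t)) := by
        intro a
        rw [hr x b a t ht, hr', ← hr x' b a t ht]
        exact ⟨fun h => h.congr fun j h1 h2 => (hfx j (by omega) (by omega)).symm,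
          fun h => h.congr fun j h1 h2 => hfx j (by omega) (by omega)⟩
      constructor
      · intro h
        obtain ⟨a, h1, h2⟩ := h.exists_mid (u := (b : ℕ) * P) (by omega) (by omega)
        exact h1.trans hg (by omega) (by omega) ((key a).mp h2)
      · intro h
        obtain ⟨a, h1, h2⟩ := h.exists_mid (u := (b : ℕ) * P) (by omega) (by omega)
        exact h1.trans hg (by omega) (by omega) ((key a).mpr h2)
  · have hcard : (Nat.card ((Fin (n / P + 1) → Fin κ' → Fin (P + 1)) ×
        (Fin (n / N + 1) → Option (Fin κ'))) : ℝ) =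
        (((P : ℝ) + 1) ^ κ) ^ (n / P + 1) * ((κ : ℝ) + 1) ^ (n / N + 1) := by
      rw [hκ]
      simp
    rw [hcard, Real.log_mul (by positivity) (by positivity)]
    have h1 := log_pow_div_add_one_le (((P : ℝ) + 1) ^ κ) (one_le_pow₀ hP1) n P
    have h2 := log_pow_div_add_one_le ((κ : ℝ) + 1) (by simp) n N
    have hP1' : (1 : ℝ) ≤ P := by exact_mod_cast hP
    -- Weakening `P + 1` to `P² + 1` lets one limit serve both entropy estimates.
    have h3 : Real.log (((P : ℝ) + 1) ^ κ) ≤ κ * Real.log ((P : ℝ) * P + 1) := by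
      rw [Real.log_pow]
      refine mul_le_mul_of_nonneg_left (Real.log_le_log (by positivity) ?_) (Nat.cast_nonneg _)
      nlinarith
    have h4 : Real.log (((P : ℝ) + 1) ^ κ) / P * n ≤ κ * Real.log ((P : ℝ) * P + 1) / P * n := by
      gcongr
    calc _ ≤ _ := add_le_add h1 h2
      _ ≤ κ * Real.log ((P : ℝ) * P + 1) / P * n + Real.log (((P : ℝ) + 1) ^ κ) +
          (Real.log ((κ : ℝ) + 1) / N * n + Real.log ((κ : ℝ) + 1)) := by gcongr
      _ = _ := by ring

end Reveal

/-! ### Extensions of finite type -/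

/-- The words of length `2 m + 1` of a shift space of finite type serve as states. -/
theorem IsFiniteType.exists_glues {A C : Type*} [TopologicalSpace A] [Finite A]
    {X : Subshift A ℤ} (hX : IsFiniteType X) {f : X.carrier → ℤ → C} (hf : IsLocal f) :
    ∃ (m : ℕ), Glues f fun (x : X.carrier) (i : ℤ) (t : Fin (2 * m + 1)) => x.1 (i + (-m) + t) := by
  obtain ⟨k, G, hG⟩ := hX
  obtain ⟨n, hn⟩ := hf.window
  -- Overlap of radius `k + n` hides the seam: forbidden words and label windows each lie where `z`
  -- agrees with `x` or with `x'`.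
  refine ⟨k + n, fun x x' i h => ?_⟩
  have hag : ∀ j : ℤ, i - (k + n : ℕ) ≤ j → j ≤ i + (k + n : ℕ) → x.1 j = x'.1 j := by
    intro j h1 h2
    have := congrFun h ⟨(j - i + (k + n : ℕ)).toNat, by omega⟩
    simp only [Int.toNat_of_nonneg (show 0 ≤ j - i + (k + n : ℕ) by omega)] at this
    rwa [show i + -((k + n : ℕ) : ℤ) + (j - i + (k + n : ℕ)) = j by ring] at this
  push_cast at hag
  let z : ℤ → A := fun j => if j ≤ i then x.1 j else x'.1 j
  have hz1 : ∀ j : ℤ, j ≤ i + (k + n) → z j = x.1 j := by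
    intro j hj
    by_cases h : j ≤ i
    · simp [z, h]
    · simp only [z, if_neg h]
      exact (hag j (by omega) (by omega)).symm
  have hz2 : ∀ j : ℤ, i - (k + n) ≤ j → z j = x'.1 j := by
    intro j hj
    by_cases h : j ≤ i
    · simp only [z, if_pos h]
      exact hag j (by omega) (by omega)
    · simp [z, h]
  have hz : z ∈ X.carrier := by
    rw [hG]
    intro v hv j ho
    by_cases hj : j ≤ i
    · have hx := hG.subset x.2
      exact hx v hv j fun t => (hz1 _ (by omega)).symm.trans (ho t)
    · have hx := hG.subset x'.2
      exact hx v hv j fun t => (hz2 _ (by omega)).symm.trans (ho t)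
  refine ⟨⟨z, hz⟩, fun j hj => ⟨funext fun t => ?_, ?_⟩, fun j hj => ⟨funext fun t => ?_, ?_⟩⟩
  · exact hz1 _ (by push_cast; omega)
  · exact hn _ _ _ fun a h1 h2 => hz1 _ (by omega)
  · exact hz2 _ (by push_cast; omega)
  · exact hn _ _ _ fun a h1 h2 => hz2 _ (by omega)

/-- Every image of a shift space of finite type has an extension of finite type, below the given
shift space, of nearly the same entropy. -/
theorem IsFiniteType.exists_isFiniteType_entropy_le {A : Type*}
    [TopologicalSpace A] [DiscreteTopology A] [Finite A] {X : Subshift A ℤ}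
    (hX : IsFiniteType X) {c : ℕ} {f : X.carrier → ℤ → Fin c} (hf : IsLocal f) {ε : ℝ}
    (hε : 0 < ε) :
    ∃ (d : ℕ) (g : X.carrier → ℤ → Fin d) (hg : IsLocal g) (π : Fin d → Fin c),
      (∀ x i, f x i = π (g x i)) ∧ IsFiniteType (rangeShift g hg) ∧
        entropy (rangeShift g hg) ≤ entropy (rangeShift f hf) + ε := by
  obtain ⟨m, hgl⟩ := hX.exists_glues hf
  set s : X.carrier → ℤ → Fin (2 * m + 1) → A := fun x i t => x.1 (i + (-m) + t)
  have hs : IsLocal s := isLocal_block X _ _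
  set κ := Nat.card (Fin (2 * m + 1) → A)
  have hN : ∀ᶠ N : ℕ in atTop, Real.log ((κ : ℝ) + 1) / N < ε / 2 :=
    (tendsto_const_div_atTop_nhds_zero_nat _).eventually_lt_const (by positivity)
  obtain ⟨N, hNε, hN0⟩ := (hN.and (eventually_gt_atTop 0)).exists
  obtain ⟨Q, hQ0, hQ⟩ := exists_marker_glue hf hs hgl hN0
  have hPt : Tendsto (fun P : ℕ => (κ : ℝ) * (Real.log ((P : ℝ) * P + 1) / P)) atTop (𝓝 0) := by
    simpa using tendsto_log_mul_self_add_one_div.const_mul (κ : ℝ)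
  have hP : ∀ᶠ P : ℕ in atTop, (κ : ℝ) * (Real.log ((P : ℝ) * P + 1) / P) < ε / 2 :=
    hPt.eventually_lt_const (by positivity)
  obtain ⟨P₀, hP₀⟩ := eventually_atTop.mp hP
  have hPQ : P₀ ≤ Q * (P₀ + 1) := by nlinarith
  obtain ⟨P, hPε, hP0, hPd⟩ : ∃ P : ℕ, (κ : ℝ) * (Real.log ((P : ℝ) * P + 1) / P) < ε / 2 ∧ 0 < P ∧
      Q ∣ P := ⟨Q * (P₀ + 1), hP₀ _ hPQ, by positivity, dvd_mul_right _ _⟩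
  obtain ⟨F, w, hF, hsep, W, hW, hglue⟩ := hQ P hP0 hPd
  obtain ⟨d, ⟨e⟩⟩ := Finite.exists_equiv_fin (Fin c × Set (Fin (2 * m + 1) → A))
  let g : X.carrier → ℤ → Fin d := fun x i => e (f x i, reveal f s F N P (f x) i (s x i))
  have hg : IsLocal g := (hf.prodMk (isLocal_reveal hf hs hF)).map e
  have hgeq : ∀ x x' i, g x i = g x' i ↔ f x i = f x' i ∧
      reveal f s F N P (f x) i (s x i) = reveal f s F N P (f x') i (s x' i) := fun x x' i =>
    e.injective.eq_iff.trans Prod.mk_inj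
  refine ⟨d, g, hg, fun a => (e.symm a).1, fun x i => by simp [g], ?_, ?_⟩
  -- With `W + 1`, the two given points overlap on `W` positions, as gluing requires.
  · refine isFiniteType_of_extend _ (W + 1) W.succ_pos ?_
    rintro n z hn ⟨_, ⟨x, rfl⟩, hx⟩ ⟨_, ⟨x', rfl⟩, hx'⟩
    push_cast at hx'
    obtain ⟨u, hu, hu'⟩ := hglue x x' (n - W) fun i h1 h2 => (hgeq x x' i).mp
      ((hx i (by omega) (by omega)).trans (hx' i (by omega) (by omega)).symm)
    refine ⟨g u, ⟨u, rfl⟩, fun i h1 h2 => ?_⟩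
    rcases lt_or_ge i n with h | h
    · rw [(hgeq u x i).mpr (hu i (by omega)), hx i h1 h]
    · rw [(hgeq u x' i).mpr (hu' i (by omega)), hx' i (by omega) h2]
  · have := entropy_le_of_reveal (Z := rangeShift g hg) (Y := rangeShift f hf) hf hs hgl hF hsep
      hN0 hP0 hf hg rfl rfl (fun _ _ _ h => h) fun x x' i h1 h2 => (hgeq x x' i).mpr ⟨h1, h2⟩
    linarith

/-! ### Factor codes between images, and the theorem -/

/-- The factor code onto the image of a local map. -/
theorem isFactorCode_rangeShift {A C : Type*} [TopologicalSpace A] [DiscreteTopology A] [Finite A]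
    [TopologicalSpace C] [T2Space C] {X : Subshift A ℤ} {f : X.carrier → ℤ → C} (hf : IsLocal f) :
    IsFactorCode (X := X) (Y := rangeShift f hf) fun x => ⟨f x, x, rfl⟩ where
  continuous := hf.continuous.subtype_mk _
  map_sigma x := Subtype.ext (funext fun i => hf.map_shift 1 x i)
  surjective := by
    rintro ⟨_, x, rfl⟩
    exact ⟨x, rfl⟩

/-- A letter-to-letter map from the image of one local map onto the image of another. -/
theorem exists_isFactorCode_of_letter_map {A C D : Type*} [TopologicalSpace A] [DiscreteTopology A]
    [Finite A] [TopologicalSpace C] [DiscreteTopology C] [TopologicalSpace D] {X : Subshift A ℤ}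
    {g : X.carrier → ℤ → C} (hg : IsLocal g) {V : Subshift D ℤ} {f : X.carrier → ℤ → D}
    (hV : V.carrier = Set.range f) (σ : C → D) (hσ : ∀ x i, f x i = σ (g x i)) :
    ∃ ψ : (rangeShift g hg).carrier → V.carrier, IsFactorCode ψ ∧
      ∀ x, (ψ ⟨g x, x, rfl⟩).1 = f x := by
  have hmem : ∀ z : (rangeShift g hg).carrier, (fun i => σ (z.1 i)) ∈ V.carrier := by
    rintro ⟨_, x, rfl⟩
    exact hV ▸ ⟨x, funext (hσ x)⟩
  refine ⟨fun z => ⟨fun i => σ (z.1 i), hmem z⟩, ⟨⟨?_, fun z => rfl⟩, ?_⟩,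
    fun x => funext fun i => (hσ x i).symm⟩
  · refine Continuous.subtype_mk (continuous_pi fun i => ?_) _
    exact continuous_of_discreteTopology.comp ((continuous_apply i).comp continuous_subtype_val)
  · rintro ⟨v, hv⟩
    obtain ⟨x, rfl⟩ := hV ▸ hv
    exact ⟨⟨g x, x, rfl⟩, Subtype.ext (funext fun i => (hσ x i).symm)⟩

end ShiftSpace

end

theorem mainTheorem1 {A B : Type*}
    [TopologicalSpace A] [DiscreteTopology A] [Finite A]
    [TopologicalSpace B] [DiscreteTopology B] [Finite B]
    (X : SymbolicDynamics.FullShift.Subshift A ℤ) (Y : SymbolicDynamics.FullShift.Subshift B ℤ)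
    (φ : X.carrier → Y.carrier)
    (hφ : ShiftSpace.IsFactorCode φ) (hX : ShiftSpace.IsFiniteType X) :
    ShiftSpace.finiteTypeEntropies φ ⊆ Set.Icc (ShiftSpace.entropy Y) (ShiftSpace.entropy X) ∧
      Set.Icc (ShiftSpace.entropy Y) (ShiftSpace.entropy X) ⊆
        closure (ShiftSpace.finiteTypeEntropies φ) := by
  constructor
  · rintro _ ⟨C, _, _, _, Z, φ₁, φ₂, h₁, h₂, -, -, rfl⟩
    exact ⟨h₂.entropy_le, h₁.entropy_le⟩
  · intro t ht
    rw [Metric.mem_closure_iff]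
    intro ε hε
    obtain ⟨c, f, hf, π, hπ, ht1, ht2⟩ :=
      hφ.exists_isLocal_entropy_near ht (show 0 < ε / 3 by positivity)
    obtain ⟨d, g, hg, ρ, hρ, hfin, hent⟩ :=
      hX.exists_isFiniteType_entropy_le hf (show 0 < ε / 3 by positivity)
    obtain ⟨φ₂, h₂, hφ₂⟩ := ShiftSpace.exists_isFactorCode_of_letter_map hg hφ.carrier_eq_range
      (π ∘ ρ) fun x i => by rw [hπ, hρ, Function.comp_apply]
    obtain ⟨ψ, hψ, -⟩ := ShiftSpace.exists_isFactorCode_of_letter_map hg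
      (V := ShiftSpace.rangeShift f hf) rfl ρ hρ
    -- Refining `f` does not lower the entropy, so `t` remains a lower bound.
    have hle := hψ.entropy_le
    refine ⟨_, ⟨Fin d, inferInstance, inferInstance, inferInstance, ShiftSpace.rangeShift g hg, _,
      φ₂, ShiftSpace.isFactorCode_rangeShift hg, h₂, funext fun x => Subtype.ext (hφ₂ x).symm, hfin,
      rfl⟩, ?_⟩
    rw [Real.dist_eq, abs_sub_lt_iff]
    constructor <;> linarith
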